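/- Consider two regular tetrahedra inscribed in the unit sphere of $\mathbb{R}^3$ (centred at the origin), and let $P$ be the convex hull of their eight vertices (counted with multiplicity). Every cube $C$ inscribed in the unit sphere (such cubes exist) has volume $\frac{8}{3\sqrt{3}}$, and this number is the maximum of the volume of $P$ over all such pairs of tetrahedra: one always has $$\mathrm{vol}_3(P)\le \mathrm{vol}_3(C)=\frac{8}{3\sqrt{3}},$$ and equality is attained for some pair. -/

import Mathlib

open MeasureTheory

/-- Euclidean three-space. -/
abbrev E3 : Type := EuclideanSpace ℝ (Fin 3)

/-- `V` is the set of the four vertices of a regular tetrahedron inscribed in the unit sphere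
(centred at the origin). -/
def IsInscribedRegularTetrahedron (V : Set E3) : Prop :=
  ∃ S : Affine.Simplex ℝ E3 3, S.Regular ∧ Set.range S.points = V ∧ V ⊆ Metric.sphere 0 1

/-- `V` is the set of the eight vertices of a (nondegenerate) cube: for some centre `c`, half-edge
`a > 0` and orthonormal frame `b`, it consists of the points `c ± a b₀ ± a b₁ ± a b₂`. -/
def IsCube (V : Set E3) : Prop :=
  ∃ (c : E3) (a : ℝ) (b : OrthonormalBasis (Fin 3) ℝ E3), 0 < a ∧
    V = {x | ∃ ε : Fin 3 → ℝ, (∀ i, ε i = 1 ∨ ε i = -1) ∧ x = c + ∑ i, (a * ε i) • b i}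

/-- `V` is the vertex set of a cube inscribed in the unit sphere (centred at the origin). -/
def IsInscribedCube (V : Set E3) : Prop :=
  IsCube V ∧ V ⊆ Metric.sphere 0 1

/-- The volume of the convex hull of a set of points. -/
noncomputable def hullVolume (V : Set E3) : ℝ :=
  volume.real (convexHull ℝ V)

/-! Triangulate the boundary of `P` without new vertices and cone every triangle from the origin,
which is interior because it already is for one tetrahedron. Of three vertices taken from two
tetrahedra, two belong to the same one, so every triangle has an edge whose endpoints have inner
product -1/3. For such a triangle with solid angle ω, the cone has volume at most α + (2/27) ω,
where α = 2/(9√3) - 2π/81 (`tripleDet_div_six_le`). Equality holds at the triangles of the cube,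
where ω = π/3. The solid angles add up to 4π, there are at most 2·8 - 4 = 12 triangles, and α ≥ 0;
hence vol P ≤ 12α + 8π/27 = 8/(3√3). A cube, split into two tetrahedra, attains this.

Angles are measured as probabilities for the uniform measure on the unit ball. Girard's theorem
(`ballProb_inter_three`) then serves twice: it yields the formula tan(ω/2) = det / (1 + x + y + z)
for the solid angle (`solidAngle_eq`), with x, y, z the inner products of the sides, and, summed
over the triangulation, Euler's bound on the number of triangles (`card_triangulation_add_four_le`).

The triangulation (`exists_boundary_triangulation`) comes from a perturbation: for generic weights
`w` near 1 the hull of the points `p i / w i` has triangular facets only, and their index triples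
triangulate the boundary of the original polytope. -/

open scoped RealInnerProductSpace

/-! ### Linear algebra of cones over triples of vectors -/

/-- The cross product on Euclidean three-space. -/
noncomputable def crossE (a b : E3) : E3 :=
  !₂[a 1 * b 2 - a 2 * b 1, a 2 * b 0 - a 0 * b 2, a 0 * b 1 - a 1 * b 0]

/-- The inner normals of the faces of the cone spanned by a positively oriented triple. -/
noncomputable def coneNormal (q : Fin 3 → E3) (m : Fin 3) : E3 := crossE (q (m + 1)) (q (m + 2))

/-- The determinant of a triple of vectors. -/
noncomputable def tripleDet (q : Fin 3 → E3) : ℝ := ⟪crossE (q 0) (q 1), q 2⟫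

/-- The open cone spanned by a positively oriented triple. -/
def openCone (q : Fin 3 → E3) : Set E3 := {x | ∀ m, 0 < ⟪coneNormal q m, x⟫}

/-- The intersection of two open half-spaces. -/
def openWedge (u v : E3) : Set E3 := {x | 0 < ⟪u, x⟫ ∧ 0 < ⟪v, x⟫}

lemma inner_E3 (x y : E3) : ⟪x, y⟫ = x 0 * y 0 + x 1 * y 1 + x 2 * y 2 := by
  simp [PiLp.inner_apply, Fin.sum_univ_three, mul_comm]

lemma inner_crossE_crossE (a b c d : E3) :
    ⟪crossE a b, crossE c d⟫ = ⟪a, c⟫ * ⟪b, d⟫ - ⟪a, d⟫ * ⟪b, c⟫ := by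
  simp only [inner_E3, crossE, Matrix.cons_val]
  ring

lemma inner_coneNormal_self (q : Fin 3 → E3) (m : Fin 3) :
    ⟪coneNormal q m, q m⟫ = tripleDet q := by
  fin_cases m <;>
  · simp [inner_E3, coneNormal, tripleDet, crossE]
    try ring

lemma inner_coneNormal_of_ne (q : Fin 3 → E3) {m k : Fin 3} (h : k ≠ m) :
    ⟪coneNormal q m, q k⟫ = 0 := by
  fin_cases m <;> fin_cases k <;> first
  | exact absurd rfl h
  | (simp [inner_E3, coneNormal, crossE]; ring)

lemma tripleDet_smul_eq_sum (q : Fin 3 → E3) (x : E3) :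
    tripleDet q • x = ∑ m, ⟪coneNormal q m, x⟫ • q m := by
  ext i
  fin_cases i <;>
  · simp [inner_E3, coneNormal, tripleDet, crossE, Fin.sum_univ_three]
    ring

lemma tripleDet_sq (q : Fin 3 → E3) (h : ∀ i, ‖q i‖ = 1) :
    tripleDet q ^ 2 = 1 + 2 * (⟪q 1, q 2⟫ * ⟪q 2, q 0⟫ * ⟪q 0, q 1⟫)
      - ⟪q 1, q 2⟫ ^ 2 - ⟪q 2, q 0⟫ ^ 2 - ⟪q 0, q 1⟫ ^ 2 := by
  have key : tripleDet q ^ 2 = ⟪q 0, q 0⟫ * ⟪q 1, q 1⟫ * ⟪q 2, q 2⟫ +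
      2 * (⟪q 1, q 2⟫ * ⟪q 2, q 0⟫ * ⟪q 0, q 1⟫) - ⟪q 0, q 0⟫ * ⟪q 1, q 2⟫ ^ 2
      - ⟪q 1, q 1⟫ * ⟪q 2, q 0⟫ ^ 2 - ⟪q 2, q 2⟫ * ⟪q 0, q 1⟫ ^ 2 := by
    simp only [tripleDet, inner_E3, crossE, Matrix.cons_val]
    ring
  simpa [real_inner_self_eq_norm_sq, h] using key

lemma tripleDet_rotate (q : Fin 3 → E3) (k : Fin 3) :
    tripleDet (fun m => q (m + k)) = tripleDet q := by
  fin_cases k <;>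
  · simp [tripleDet, inner_E3, crossE]
    try ring

lemma tripleDet_swap (q : Fin 3 → E3) : tripleDet ![q 0, q 2, q 1] = - tripleDet q := by
  simp [tripleDet, inner_E3, crossE]
  ring

lemma openCone_rotate (q : Fin 3 → E3) (k : Fin 3) :
    openCone (fun m => q (m + k)) = openCone q := by
  ext x
  have h (m : Fin 3) : coneNormal (fun m => q (m + k)) m = coneNormal q (m + k) := by
    simp only [coneNormal]
    congr 2 <;> abel
  simp only [openCone, Set.mem_ofPred_eq, h]
  exact (Equiv.addRight k).forall_congr_right (q := fun m => 0 < ⟪coneNormal q m, x⟫)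

lemma isOpen_openCone (q : Fin 3 → E3) : IsOpen (openCone q) := by
  simp only [openCone, Set.ofPred_forall]
  exact isOpen_iInter_of_finite fun m => isOpen_lt (by fun_prop) (by fun_prop)

lemma isOpen_halfspace (u : E3) : IsOpen {x : E3 | 0 < ⟪u, x⟫} :=
  isOpen_lt continuous_const (by fun_prop)

lemma isOpen_openWedge (u v : E3) : IsOpen (openWedge u v) :=
  (isOpen_halfspace u).inter (isOpen_halfspace v)

/-! ### Angles as probabilities: the measure of a wedge -/

/-- The uniform probability measure on the unit ball. -/
noncomputable def ballProb : Measure E3 := ProbabilityTheory.cond volume (Metric.ball 0 1)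

instance : IsProbabilityMeasure ballProb :=
  ProbabilityTheory.cond_isProbabilityMeasure_of_finite
    (Metric.isOpen_ball.measure_pos _ (Metric.nonempty_ball.2 one_pos)).ne' measure_ball_lt_top.ne

lemma ballProb_absolutelyContinuous : ballProb ≪ volume :=
  ProbabilityTheory.cond_absolutelyContinuous

lemma ballProb_real_apply (K : Set E3) : ballProb.real K =
    (volume.real (Metric.ball (0 : E3) 1))⁻¹ * volume.real (Metric.ball (0 : E3) 1 ∩ K) := by
  simp only [ballProb, measureReal_def, ProbabilityTheory.cond_apply measurableSet_ball,
    ENNReal.toReal_mul, ENNReal.toReal_inv]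

lemma lintegral_E3 (f : ℝ × (ℝ × ℝ) → ENNReal) (hf : Measurable f) :
    ∫⁻ x : E3, f (x 2, (x 0, x 1)) = ∫⁻ z, ∫⁻ p : ℝ × ℝ, f (z, p) := by
  have h1 := PiLp.volume_preserving_ofLp (Fin 3)
  have h2 := volume_preserving_piFinSuccAbove (fun _ : Fin 3 => ℝ) 2
  have h3 : MeasurePreserving (Prod.map id (MeasurableEquiv.finTwoArrow (α := ℝ)))
      (volume : Measure (ℝ × (Fin 2 → ℝ))) (volume : Measure (ℝ × (ℝ × ℝ))) :=
    (MeasurePreserving.id volume).prod (volume_preserving_finTwoArrow ℝ)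
  rw [← lintegral_prod _ hf.aemeasurable]
  exact ((h3.comp h2).comp h1).lintegral_comp hf

/-- In cylindrical coordinates, the volume of the part of the unit ball in a sector
is proportional to the measure of the set of angles. -/
lemma volume_sector_inter_ball (K : Set E3) (hK : MeasurableSet K) (Φ : Set ℝ)
    (hΦ : MeasurableSet Φ)
    (h : ∀ r > 0, ∀ φ ∈ Set.Ioo (-Real.pi) Real.pi, ∀ z : ℝ,
      (!₂[r * Real.cos φ, r * Real.sin φ, z] ∈ K ↔ φ ∈ Φ)) :
    volume (Metric.ball 0 1 ∩ K) = (∫⁻ z : ℝ, ∫⁻ r in Set.Ioi (0 : ℝ),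
      ENNReal.ofReal r * {r : ℝ | r ^ 2 + z ^ 2 < 1}.indicator 1 r) *
      volume (Φ ∩ Set.Ioo (-Real.pi) Real.pi) := by
  let mk : ℝ × (ℝ × ℝ) → E3 := fun p => !₂[p.2.1, p.2.2, p.1]
  have hmk : Measurable mk := by
    have : Continuous mk := by
      refine (PiLp.continuous_toLp 2 _).comp ?_
      refine continuous_pi fun i => ?_
      fin_cases i <;> simp <;> fun_prop
    exact this.measurable
  have hB : MeasurableSet (Metric.ball (0 : E3) 1 ∩ K) := measurableSet_ball.inter hK
  have hball (r φ z : ℝ) : (!₂[r * Real.cos φ, r * Real.sin φ, z] : E3) ∈ Metric.ball 0 1 ↔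
      r ^ 2 + z ^ 2 < 1 := by
    rw [mem_ball_zero_iff, ← sq_lt_one_iff₀ (norm_nonneg _), EuclideanSpace.norm_sq_eq]
    simp only [Fin.sum_univ_three, Real.norm_eq_abs, sq_abs, Matrix.cons_val]
    rw [mul_pow, mul_pow, ← mul_add, Real.cos_sq_add_sin_sq, mul_one]
  have step (z : ℝ) : ∫⁻ p : ℝ × ℝ, (Metric.ball (0 : E3) 1 ∩ K).indicator 1 (mk (z, p)) =
      (∫⁻ r in Set.Ioi (0 : ℝ), ENNReal.ofReal r * {r : ℝ | r ^ 2 + z ^ 2 < 1}.indicator 1 r) *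
      volume (Φ ∩ Set.Ioo (-Real.pi) Real.pi) := by
    rw [← lintegral_comp_polarCoord_symm, polarCoord_target]
    have hm1 : MeasurableSet {r : ℝ | r ^ 2 + z ^ 2 < 1} :=
      (isOpen_lt (by fun_prop) continuous_const).measurableSet
    calc _ = ∫⁻ p in Set.Ioi (0 : ℝ) ×ˢ Set.Ioo (-Real.pi) Real.pi,
          (ENNReal.ofReal p.1 * {r : ℝ | r ^ 2 + z ^ 2 < 1}.indicator 1 p.1) *
            Φ.indicator 1 p.2 := by
          refine setLIntegral_congr_fun (measurableSet_Ioi.prod measurableSet_Ioo) ?_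
          rintro ⟨r, φ⟩ ⟨hr, hφ⟩
          have h1 := h r hr φ hφ z
          have h2 := hball r φ z
          simp only [polarCoord_symm_apply, smul_eq_mul, mk, mul_assoc]
          congr 1
          by_cases hA : φ ∈ Φ <;> by_cases hC : r ^ 2 + z ^ 2 < 1 <;>
            simp [Set.indicator, h1, h2, hA, hC]
      _ = _ := by
          rw [Measure.volume_eq_prod, ← Measure.prod_restrict,
            lintegral_prod_mul (f := fun r => ENNReal.ofReal r *
              {r : ℝ | r ^ 2 + z ^ 2 < 1}.indicator 1 r) (g := Φ.indicator 1)]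
          · rw [lintegral_indicator_one hΦ, Measure.restrict_apply hΦ]
          · exact (ENNReal.measurable_ofReal.mul
              (measurable_one.indicator hm1)).aemeasurable
          · exact (measurable_one.indicator hΦ).aemeasurable
  calc volume (Metric.ball 0 1 ∩ K)
      = ∫⁻ x : E3, (Metric.ball (0 : E3) 1 ∩ K).indicator 1 (mk (x 2, (x 0, x 1))) := by
        rw [← lintegral_indicator_one hB]
        refine lintegral_congr fun x => ?_
        congr 1
        ext i; fin_cases i <;> simp [mk]
    _ = _ := by
        rw [lintegral_E3 (fun p => (Metric.ball (0 : E3) 1 ∩ K).indicator 1 (mk p))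
          ((measurable_one.indicator hB).comp hmk)]
        simp_rw [step]
        rw [lintegral_mul_const']
        exact ((measure_mono Set.inter_subset_right).trans_lt (by simp)).ne

lemma ballProb_sector (K : Set E3) (hK : MeasurableSet K) (Φ : Set ℝ)
    (hΦ : MeasurableSet Φ)
    (h : ∀ r > 0, ∀ φ ∈ Set.Ioo (-Real.pi) Real.pi, ∀ z : ℝ,
      (!₂[r * Real.cos φ, r * Real.sin φ, z] ∈ K ↔ φ ∈ Φ)) :
    ballProb.real K = volume.real (Φ ∩ Set.Ioo (-Real.pi) Real.pi) / (2 * Real.pi) := by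
  have h1 := volume_sector_inter_ball K hK Φ hΦ h
  -- The full ball is a sector with the same radial factor, so the factor cancels and need not be
  -- evaluated.
  have h2 := volume_sector_inter_ball Set.univ MeasurableSet.univ Set.univ MeasurableSet.univ
    (by simp)
  set C := (∫⁻ z : ℝ, ∫⁻ r in Set.Ioi (0 : ℝ),
      ENNReal.ofReal r * {r : ℝ | r ^ 2 + z ^ 2 < 1}.indicator 1 r)
  rw [ballProb_real_apply]
  have e1 : volume.real (Metric.ball (0 : E3) 1 ∩ K) = C.toReal *
      volume.real (Φ ∩ Set.Ioo (-Real.pi) Real.pi) := by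
    simp only [Measure.real, h1, ENNReal.toReal_mul]
  have e2 : volume.real (Metric.ball (0 : E3) 1) = C.toReal * (2 * Real.pi) := by
    simp only [Set.inter_univ, Set.univ_inter, Real.volume_Ioo] at h2
    rw [Measure.real, h2, ENNReal.toReal_mul, ENNReal.toReal_ofReal (by linarith [Real.pi_pos])]
    ring
  have hpos : 0 < volume.real (Metric.ball (0 : E3) 1) :=
    ENNReal.toReal_pos (Metric.isOpen_ball.measure_pos _ (Metric.nonempty_ball.2 one_pos)).ne'
      measure_ball_lt_top.ne
  have hC : C.toReal ≠ 0 := by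
    intro h0
    rw [e2, h0] at hpos
    simp at hpos
  rw [e1, e2]
  field_simp

lemma ballProb_preimage_isometry (f : E3 ≃ₗᵢ[ℝ] E3) (K : Set E3) (hK : MeasurableSet K) :
    ballProb.real (f ⁻¹' K) = ballProb.real K := by
  rw [ballProb_real_apply, ballProb_real_apply]
  congr 1
  have : Metric.ball (0 : E3) 1 ∩ f ⁻¹' K = f ⁻¹' (Metric.ball 0 1 ∩ K) := by
    ext x; simp
  rw [this, measureReal_def, measureReal_def,
    f.measurePreserving.measure_preimage (measurableSet_ball.inter hK).nullMeasurableSet]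

/-- In this frame `u` points along the first axis and `v` lies in a half-plane through it, so that
the wedge becomes a sector in cylindrical coordinates. -/
lemma exists_adapted_orthonormalBasis (u v : E3) (hu : u ≠ 0) :
    ∃ b : OrthonormalBasis (Fin 3) ℝ E3, u = ‖u‖ • b 0 ∧ 0 ≤ ⟪b 1, v⟫ ∧ ⟪b 2, v⟫ = 0 := by
  have hu' : ‖u‖ ≠ 0 := norm_ne_zero_iff.2 hu
  set e : E3 := ‖u‖⁻¹ • u with he
  have hen : ‖e‖ = 1 := by rw [he, norm_smul, norm_inv, norm_norm, inv_mul_cancel₀ hu']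
  have hee : ⟪e, e⟫ = 1 := by rw [real_inner_self_eq_norm_sq, hen]; norm_num
  have hue : u = ‖u‖ • e := by rw [he, smul_smul, mul_inv_cancel₀ hu', one_smul]
  set w : E3 := v - ⟪e, v⟫ • e with hw
  have hew : ⟪e, w⟫ = 0 := by
    rw [hw, inner_sub_right, inner_smul_right, hee]; ring
  have hv : v = ⟪e, v⟫ • e + w := by rw [hw]; abel
  by_cases hw0 : w = 0
  · have hs : Orthonormal ℝ (({0} : Set (Fin 3)).domRestrict ![e, 0, 0]) := by
      constructor
      · rintro ⟨i, rfl⟩; simpa [Set.domRestrict] using hen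
      · rintro ⟨i, rfl⟩ ⟨j, rfl⟩ h; exact absurd rfl h
    obtain ⟨b, hb⟩ := hs.exists_orthonormalBasis_extension_of_card_eq (by simp)
    have h0 : b 0 = e := by simpa using hb 0 rfl
    have key (i : Fin 3) (hi : i ≠ 0) : ⟪b i, v⟫ = 0 := by
      rw [hv, hw0, add_zero, inner_smul_right, ← h0, b.orthonormal.2 hi, mul_zero]
    exact ⟨b, by rw [h0, ← hue], (key 1 (by decide)).ge, key 2 (by decide)⟩
  · have hw' : ‖w‖ ≠ 0 := norm_ne_zero_iff.2 hw0
    set f : E3 := ‖w‖⁻¹ • w with hf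
    have hfn : ‖f‖ = 1 := by rw [hf, norm_smul, norm_inv, norm_norm, inv_mul_cancel₀ hw']
    have hwf : w = ‖w‖ • f := by rw [hf, smul_smul, mul_inv_cancel₀ hw', one_smul]
    have hef : ⟪e, f⟫ = 0 := by rw [hf, inner_smul_right, hew, mul_zero]
    have hs : Orthonormal ℝ (({0, 1} : Set (Fin 3)).domRestrict ![e, f, 0]) := by
      constructor
      · rintro ⟨i, rfl | rfl⟩ <;> simpa [Set.domRestrict]
      · rintro ⟨i, rfl | rfl⟩ ⟨j, rfl | rfl⟩ h
        · exact absurd rfl h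
        · simpa [Set.domRestrict] using hef
        · simpa [Set.domRestrict, real_inner_comm] using hef
        · exact absurd rfl h
    obtain ⟨b, hb⟩ := hs.exists_orthonormalBasis_extension_of_card_eq (by simp)
    have h0 : b 0 = e := by simpa using hb 0 (by simp)
    have h1 : b 1 = f := by simpa using hb 1 (by simp)
    have hff : ⟪f, f⟫ = 1 := by rw [real_inner_self_eq_norm_sq, hfn]; norm_num
    have hvv : v = ⟪e, v⟫ • b 0 + ‖w‖ • b 1 := by rw [h0, h1, ← hwf, ← hv]
    refine ⟨b, by rw [h0, ← hue], ?_, ?_⟩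
    · rw [hv, inner_add_right, inner_smul_right, h1, real_inner_comm e f, hef, hwf, inner_smul_right,
        hff]
      simp
    · rw [hvv, inner_add_right, inner_smul_right, inner_smul_right, b.orthonormal.2 (by decide),
        b.orthonormal.2 (by decide)]
      simp

/-- The measure of a wedge is proportional to its dihedral angle. -/
theorem ballProb_openWedge (u v : E3) (hu : u ≠ 0) (hv : v ≠ 0) :
    ballProb.real (openWedge u v) =
      (Real.pi - InnerProductGeometry.angle u v) / (2 * Real.pi) := by
  obtain ⟨b, hb0, hb1, hb2⟩ := exists_adapted_orthonormalBasis u v hu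
  set θ := InnerProductGeometry.angle u v with hθ
  have hu' : 0 < ‖u‖ := norm_pos_iff.2 hu
  have hv' : 0 < ‖v‖ := norm_pos_iff.2 hv
  have hθ0 : 0 ≤ θ := InnerProductGeometry.angle_nonneg _ _
  have hθπ : θ ≤ Real.pi := InnerProductGeometry.angle_le_pi _ _
  have hc : ⟪b 0, v⟫ = ‖v‖ * Real.cos θ := by
    have h1 := InnerProductGeometry.cos_angle_mul_norm_mul_norm u v
    rw [← hθ] at h1
    have h2 : ⟪u, v⟫ = ‖u‖ * ⟪b 0, v⟫ := by
      conv_lhs => rw [hb0, real_inner_smul_left]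
    rw [h2] at h1
    have : ‖u‖ * (⟪b 0, v⟫ - ‖v‖ * Real.cos θ) = 0 := by linarith
    rcases mul_eq_zero.1 this with h | h
    · exact absurd h hu'.ne'
    · linarith
  have hs : ⟪b 1, v⟫ = ‖v‖ * Real.sin θ := by
    have h1 : ‖v‖ ^ 2 = ⟪b 0, v⟫ ^ 2 + ⟪b 1, v⟫ ^ 2 + ⟪b 2, v⟫ ^ 2 := by
      rw [← b.sum_sq_norm_inner_right v, Fin.sum_univ_three]
      simp [sq_abs]
    rw [hb2, hc] at h1
    have h2 : ⟪b 1, v⟫ ^ 2 = (‖v‖ * Real.sin θ) ^ 2 := by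
      rw [mul_pow, Real.sin_sq]; linarith
    exact (sq_eq_sq₀ hb1 (mul_nonneg hv'.le (Real.sin_nonneg_of_nonneg_of_le_pi hθ0 hθπ))).1 h2
  have hpre : openWedge u v = b.repr ⁻¹' openWedge (b.repr u) (b.repr v) := by
    ext x; simp [openWedge]
  rw [hpre, ballProb_preimage_isometry _ _ (isOpen_openWedge _ _).measurableSet]
  have hru : ∀ x : E3, ⟪b.repr u, x⟫ = ‖u‖ * x 0 := by
    intro x
    have e0 : b.repr u 0 = ‖u‖ := by
      rw [b.repr_apply_apply, hb0]; simp [inner_smul_right, norm_smul]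
    have e1 : b.repr u 1 = 0 := by
      rw [b.repr_apply_apply, hb0, inner_smul_right, b.orthonormal.2 (by decide), mul_zero]
    have e2 : b.repr u 2 = 0 := by
      rw [b.repr_apply_apply, hb0, inner_smul_right, b.orthonormal.2 (by decide), mul_zero]
    rw [inner_E3, e0, e1, e2]; ring
  have hrv : ∀ x : E3, ⟪b.repr v, x⟫ = ‖v‖ * (Real.cos θ * x 0 + Real.sin θ * x 1) := by
    intro x
    rw [inner_E3, b.repr_apply_apply, b.repr_apply_apply, b.repr_apply_apply, hc, hs, hb2]; ring
  -- The conditions are cos φ > 0 and cos (φ - θ) > 0 with θ in [0, π]; they cut out an interval of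
  -- length π - θ.
  rw [ballProb_sector _ (isOpen_openWedge _ _).measurableSet
    (Set.Ioo (θ - Real.pi / 2) (Real.pi / 2)) measurableSet_Ioo]
  · congr 1
    rw [Set.inter_eq_left.2
        (Set.Ioo_subset_Ioo (by linarith [Real.pi_pos]) (by linarith [Real.pi_pos])),
      Real.volume_real_Ioo_of_le (by linarith)]
    ring
  · intro r hr φ hφ z
    simp only [openWedge, Set.mem_ofPred_eq, hru, hrv, Matrix.cons_val]
    have : Real.cos θ * (r * Real.cos φ) + Real.sin θ * (r * Real.sin φ) =
        r * Real.cos (φ - θ) := by rw [Real.cos_sub]; ring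
    rw [this, mul_pos_iff_of_pos_left hu', mul_pos_iff_of_pos_left hv',
      mul_pos_iff_of_pos_left hr, mul_pos_iff_of_pos_left hr]
    obtain ⟨h1, h2⟩ := hφ
    constructor
    · rintro ⟨ha, hb⟩
      have hφ2 : φ < Real.pi / 2 := by
        by_contra! hcon
        linarith [Real.cos_nonpos_of_pi_div_two_le_of_le hcon (by linarith)]
      have hφ3 : -(Real.pi / 2) < φ := by
        by_contra! hcon
        have := Real.cos_nonpos_of_pi_div_two_le_of_le (x := -φ) (by linarith) (by linarith)
        rw [Real.cos_neg] at this
        linarith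
      refine ⟨?_, hφ2⟩
      by_contra! hcon
      have := Real.cos_nonpos_of_pi_div_two_le_of_le (x := -(φ - θ)) (by linarith) (by linarith)
      rw [Real.cos_neg] at this
      linarith
    · rintro ⟨ha, hb⟩
      exact ⟨Real.cos_pos_of_mem_Ioo ⟨by linarith, by linarith⟩,
        Real.cos_pos_of_mem_Ioo ⟨by linarith, by linarith⟩⟩

/-! ### Girard's theorem -/

/-- The open half-space with inner normal `u`. -/
def openHalfspace (u : E3) : Set E3 := {x | 0 < ⟪u, x⟫}

lemma isOpen_openHalfspace (u : E3) : IsOpen (openHalfspace u) := isOpen_halfspace u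

lemma openWedge_eq_inter (u v : E3) : openWedge u v = openHalfspace u ∩ openHalfspace v := rfl

lemma openCone_eq_inter (q : Fin 3 → E3) : openCone q = openHalfspace (coneNormal q 0) ∩
    openHalfspace (coneNormal q 1) ∩ openHalfspace (coneNormal q 2) := by
  ext x
  simp [openCone, openHalfspace, Fin.forall_fin_succ, and_assoc]

lemma volume_orthogonal_eq_zero (u : E3) (hu : u ≠ 0) : volume {x : E3 | ⟪u, x⟫ = 0} = 0 := by
  have h := Measure.addHaar_submodule (volume : Measure E3) (LinearMap.ker (innerₛₗ ℝ u)) (by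
    intro h
    rw [LinearMap.ker_eq_top] at h
    have : ⟪u, u⟫ = (0 : ℝ) := by simpa using congrArg (fun f => f u) h
    exact hu (inner_self_eq_zero.1 this))
  convert h using 2
  ext x; simp

lemma ballProb_split (K : Set E3) (u : E3) (hu : u ≠ 0) :
    ballProb.real K = ballProb.real (K ∩ openHalfspace u) +
      ballProb.real (K ∩ openHalfspace (-u)) := by
  rw [← measureReal_inter_add_sdiff (s := K) (isOpen_openHalfspace u).measurableSet]
  congr 1
  refine measureReal_congr ?_
  have h0 : ∀ᵐ x ∂ballProb, ⟪u, x⟫ ≠ (0 : ℝ) :=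
    ballProb_absolutelyContinuous.ae_le (measure_eq_zero_iff_ae_notMem.1
      (volume_orthogonal_eq_zero u hu))
  filter_upwards [h0] with x hx
  refine propext ?_
  change (x ∈ K ∧ ¬ (0 < ⟪u, x⟫)) ↔ (x ∈ K ∧ 0 < ⟪-u, x⟫)
  rw [inner_neg_left, not_lt, neg_pos, lt_iff_le_and_ne]
  simp [hx]

lemma ballProb_neg (K : Set E3) (hK : MeasurableSet K) : ballProb.real (-K) = ballProb.real K :=
  ballProb_preimage_isometry (LinearIsometryEquiv.neg ℝ) K hK

lemma ballProb_openHalfspace (u : E3) (hu : u ≠ 0) : ballProb.real (openHalfspace u) = 1 / 2 := by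
  have h := ballProb_openWedge u u hu hu
  rw [openWedge_eq_inter, Set.inter_self, InnerProductGeometry.angle_self hu] at h
  rw [h]
  field_simp [Real.pi_ne_zero]
  simp

/-- Girard's theorem for the intersection of three half-spaces. -/
theorem ballProb_inter_three (u v w : E3) (hu : u ≠ 0) (hv : v ≠ 0) (hw : w ≠ 0) :
    2 * ballProb.real (openHalfspace u ∩ openHalfspace v ∩ openHalfspace w) =
      ballProb.real (openWedge v w) + ballProb.real (openWedge w u) +
        ballProb.real (openWedge u v) - 1 / 2 := by
  have hm (a : E3) : MeasurableSet (openHalfspace a) := (isOpen_openHalfspace a).measurableSet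
  -- Cutting v ∩ w by u and w ∩ u by v leaves the remainders (v, w, -u) and (w, u, -v). Up to the
  -- antipodal map these are the two pieces into which w cuts u ∩ (-v), and that set has measure 1/2
  -- minus the wedge of u and v.
  have e1 := ballProb_split (openHalfspace v ∩ openHalfspace w) u hu
  have e2 := ballProb_split (openHalfspace w ∩ openHalfspace u) v hv
  have e3 := ballProb_split (openHalfspace u ∩ openHalfspace v) w hw
  have e4 := ballProb_split (openHalfspace u) v hv
  have e5 := ballProb_split (openHalfspace u ∩ openHalfspace (-v)) w hw
  have e6 := ballProb_neg (openHalfspace u ∩ openHalfspace (-v) ∩ openHalfspace (-w))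
    (((hm _).inter (hm _)).inter (hm _))
  have e7 : -(openHalfspace u ∩ openHalfspace (-v) ∩ openHalfspace (-w)) =
      openHalfspace v ∩ openHalfspace w ∩ openHalfspace (-u) := by
    ext x
    simp only [openHalfspace, Set.mem_neg, Set.mem_inter_iff, Set.mem_ofPred_eq, inner_neg_left,
      inner_neg_right, neg_neg]
    tauto
  have s1 : openHalfspace v ∩ openHalfspace w ∩ openHalfspace u =
      openHalfspace u ∩ openHalfspace v ∩ openHalfspace w := by ext x; simp; tauto
  have s2 : openHalfspace w ∩ openHalfspace u ∩ openHalfspace v =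
      openHalfspace u ∩ openHalfspace v ∩ openHalfspace w := by ext x; simp; tauto
  have s3 : openHalfspace u ∩ openHalfspace (-v) ∩ openHalfspace w =
      openHalfspace w ∩ openHalfspace u ∩ openHalfspace (-v) := by ext x; simp; tauto
  rw [e7] at e6
  rw [s1] at e1
  rw [s2] at e2
  rw [s3] at e5
  rw [ballProb_openHalfspace u hu] at e4
  simp only [openWedge_eq_inter]
  linarith

lemma coneNormal_ne_zero (q : Fin 3 → E3) (hq : 0 < tripleDet q) (m : Fin 3) :
    coneNormal q m ≠ 0 := by
  intro h
  have := inner_coneNormal_self q m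
  rw [h, inner_zero_left] at this
  exact hq.ne this

/-- The wedge of the cone spanned by `q` along the edge `q m`. -/
def edgeWedge (q : Fin 3 → E3) (m : Fin 3) : Set E3 :=
  openWedge (coneNormal q (m + 1)) (coneNormal q (m + 2))

theorem two_mul_ballProb_openCone (q : Fin 3 → E3) (hq : 0 < tripleDet q) :
    2 * ballProb.real (openCone q) = ∑ m, ballProb.real (edgeWedge q m) - 1 / 2 := by
  have h := coneNormal_ne_zero q hq
  rw [openCone_eq_inter, ballProb_inter_three _ _ _ (h 0) (h 1) (h 2), Fin.sum_univ_three]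
  rfl

lemma ballProb_openCone_le_half (q : Fin 3 → E3) (hq : 0 < tripleDet q) :
    ballProb.real (openCone q) ≤ 1 / 2 := by
  rw [← ballProb_openHalfspace _ (coneNormal_ne_zero q hq 0), openCone_eq_inter, Set.inter_assoc]
  exact measureReal_mono Set.inter_subset_left

/-! ### The solid angle of a spherical triangle -/

/-- Exponentials turn sums of dihedral angles into products. By Lagrange's identity, `h` says that
the cross product of `n` and `k` has length `d`; for two face normals of a cone over unit vectors,
this length is the determinant, whichever edge is chosen. -/
lemma cexp_pi_sub_angle (n k : E3) (d : ℝ) (hd : 0 ≤ d)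
    (h : ‖n‖ ^ 2 * ‖k‖ ^ 2 - ⟪n, k⟫ ^ 2 = d ^ 2) :
    Complex.exp (((Real.pi - InnerProductGeometry.angle n k : ℝ) : ℂ) * Complex.I) *
      (‖n‖ * ‖k‖ : ℝ) = ((-⟪n, k⟫ : ℝ) : ℂ) + d * Complex.I := by
  have h1 := InnerProductGeometry.cos_angle_mul_norm_mul_norm n k
  have h2 := InnerProductGeometry.sin_angle_mul_norm_mul_norm n k
  rw [real_inner_self_eq_norm_sq, real_inner_self_eq_norm_sq, ← sq, h, Real.sqrt_sq hd] at h2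
  rw [Complex.exp_mul_I, ← Complex.ofReal_cos, ← Complex.ofReal_sin, Real.cos_pi_sub,
    Real.sin_pi_sub, ← h2, ← h1]
  push_cast
  ring

/-- The solid angle of the cone spanned by three unit vectors. -/
theorem solidAngle_eq (q : Fin 3 → E3) (hq : 0 < tripleDet q) (hn : ∀ i, ‖q i‖ = 1) :
    4 * Real.pi * ballProb.real (openCone q) =
      2 * Complex.arg (((1 + ⟪q 1, q 2⟫ + ⟪q 2, q 0⟫ + ⟪q 0, q 1⟫ : ℝ) : ℂ) +
        tripleDet q * Complex.I) := by
  have hN := coneNormal_ne_zero q hq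
  have hd2 := tripleDet_sq q hn
  have hτ1 : 0 ≤ ballProb.real (openCone q) := measureReal_nonneg
  have hτ2 := ballProb_openCone_le_half q hq
  have hG := two_mul_ballProb_openCone q hq
  simp only [edgeWedge, Fin.sum_univ_three] at hG
  rw [ballProb_openWedge _ _ (hN _) (hN _), ballProb_openWedge _ _ (hN _) (hN _),
    ballProb_openWedge _ _ (hN _) (hN _)] at hG
  have hself (i : Fin 3) : ⟪q i, q i⟫ = (1 : ℝ) := by
    rw [real_inner_self_eq_norm_sq, hn]; norm_num
  have n0 : ‖coneNormal q 0‖ ^ 2 = 1 - ⟪q 1, q 2⟫ ^ 2 := by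
    rw [← real_inner_self_eq_norm_sq]
    change ⟪crossE (q 1) (q 2), crossE (q 1) (q 2)⟫ = _
    rw [inner_crossE_crossE, hself, hself, real_inner_comm (q 1) (q 2)]; ring
  have n1 : ‖coneNormal q 1‖ ^ 2 = 1 - ⟪q 2, q 0⟫ ^ 2 := by
    rw [← real_inner_self_eq_norm_sq]
    change ⟪crossE (q 2) (q 0), crossE (q 2) (q 0)⟫ = _
    rw [inner_crossE_crossE, hself, hself, real_inner_comm (q 2) (q 0)]; ring
  have n2 : ‖coneNormal q 2‖ ^ 2 = 1 - ⟪q 0, q 1⟫ ^ 2 := by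
    rw [← real_inner_self_eq_norm_sq]
    change ⟪crossE (q 0) (q 1), crossE (q 0) (q 1)⟫ = _
    rw [inner_crossE_crossE, hself, hself, real_inner_comm (q 0) (q 1)]; ring
  have i12 : ⟪coneNormal q 1, coneNormal q 2⟫ = ⟪q 2, q 0⟫ * ⟪q 0, q 1⟫ - ⟪q 1, q 2⟫ := by
    change ⟪crossE (q 2) (q 0), crossE (q 0) (q 1)⟫ = _
    rw [inner_crossE_crossE, hself, real_inner_comm (q 1) (q 2)]; ring
  have i20 : ⟪coneNormal q 2, coneNormal q 0⟫ = ⟪q 0, q 1⟫ * ⟪q 1, q 2⟫ - ⟪q 2, q 0⟫ := by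
    change ⟪crossE (q 0) (q 1), crossE (q 1) (q 2)⟫ = _
    rw [inner_crossE_crossE, hself, real_inner_comm (q 2) (q 0)]; ring
  have i01 : ⟪coneNormal q 0, coneNormal q 1⟫ = ⟪q 1, q 2⟫ * ⟪q 2, q 0⟫ - ⟪q 0, q 1⟫ := by
    change ⟪crossE (q 1) (q 2), crossE (q 2) (q 0)⟫ = _
    rw [inner_crossE_crossE, hself, real_inner_comm (q 0) (q 1)]; ring
  set x : ℝ := ⟪q 1, q 2⟫
  set y : ℝ := ⟪q 2, q 0⟫
  set z : ℝ := ⟪q 0, q 1⟫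
  set d := tripleDet q
  have E0 := cexp_pi_sub_angle (coneNormal q 1) (coneNormal q 2) d hq.le (by rw [n1, n2, i12, hd2]; ring)
  have E1 := cexp_pi_sub_angle (coneNormal q 2) (coneNormal q 0) d hq.le (by rw [n2, n0, i20, hd2]; ring)
  have E2 := cexp_pi_sub_angle (coneNormal q 0) (coneNormal q 1) d hq.le (by rw [n0, n1, i01, hd2]; ring)
  have hG' : 4 * Real.pi * ballProb.real (openCone q) =
      (Real.pi - InnerProductGeometry.angle (coneNormal q 1) (coneNormal q 2)) +
      (Real.pi - InnerProductGeometry.angle (coneNormal q 2) (coneNormal q 0)) +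
      (Real.pi - InnerProductGeometry.angle (coneNormal q 0) (coneNormal q 1)) - Real.pi := by
    have : 4 * Real.pi * ballProb.real (openCone q) =
      2 * Real.pi * (2 * ballProb.real (openCone q)) := by ring
    rw [this, hG]
    field_simp [Real.pi_ne_zero]
    rfl
  set A := Real.pi - InnerProductGeometry.angle (coneNormal q 1) (coneNormal q 2)
  set B := Real.pi - InnerProductGeometry.angle (coneNormal q 2) (coneNormal q 0)
  set C := Real.pi - InnerProductGeometry.angle (coneNormal q 0) (coneNormal q 1)
  set τ := 4 * Real.pi * ballProb.real (openCone q)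
  have hτ0 : 0 ≤ τ := by positivity
  have hτ3 : τ ≤ 2 * Real.pi := by
    have : τ = 4 * Real.pi * ballProb.real (openCone q) := rfl
    nlinarith [Real.pi_pos]
  -- The real part of `W` is negative for large triangles, hence `arg` rather than an arctangent.
  set W : ℂ := ((1 + x + y + z : ℝ) : ℂ) + d * Complex.I with hW
  have hWim : W.im = d := by simp [hW]
  have hψ1 : 0 < Complex.arg W := by
    rcases (Complex.arg_nonneg_iff.2 (hWim ▸ hq.le)).lt_or_eq with h | h
    · exact h
    · exact absurd (Complex.arg_eq_zero_iff.1 h.symm).2 (hWim ▸ hq.ne')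
  have hψ2 : Complex.arg W < Real.pi := by
    refine (Complex.arg_le_pi W).lt_of_ne fun h => ?_
    exact hq.ne' (hWim ▸ (Complex.arg_eq_pi_iff.1 h).2)
  have hx1 : 0 < 1 - x ^ 2 := n0 ▸ pow_pos (norm_pos_iff.2 (hN 0)) 2
  have hy1 : 0 < 1 - y ^ 2 := n1 ▸ pow_pos (norm_pos_iff.2 (hN 1)) 2
  have hz1 : 0 < 1 - z ^ 2 := n2 ▸ pow_pos (norm_pos_iff.2 (hN 2)) 2
  have hWn : ‖W‖ ^ 2 = 2 * ((1 + x) * (1 + y) * (1 + z)) := by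
    rw [Complex.sq_norm, Complex.normSq_apply, hWim]
    have : W.re = 1 + x + y + z := by simp [hW]
    rw [this, ← sq d, hd2]; ring
  have hdC : (d : ℂ) ^ 2 = 1 + 2 * (x * y * z) - x ^ 2 - y ^ 2 - z ^ 2 := by
    exact_mod_cast congrArg (fun r : ℝ => (r : ℂ)) hd2
  -- By Girard, τ is the sum of the dihedral angles minus π. Multiplying the exponentials and
  -- eliminating d² by the Gram determinant leaves a positive multiple of W².
  have hexpτ : Complex.exp ((τ : ℂ) * Complex.I) * ((1 - x ^ 2) * (1 - y ^ 2) * (1 - z ^ 2) : ℝ) =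
      W ^ 2 * ((1 - x) * (1 - y) * (1 - z) / 2 : ℝ) := by
    have e : Complex.exp ((τ : ℂ) * Complex.I) = - (Complex.exp ((A : ℂ) * Complex.I) *
        Complex.exp ((B : ℂ) * Complex.I) * Complex.exp ((C : ℂ) * Complex.I)) := by
      rw [← Complex.exp_add, ← Complex.exp_add, hG', ← mul_neg_one, ← Complex.exp_neg_pi_mul_I,
        ← Complex.exp_add]
      congr 1
      push_cast
      ring
    have p : ((1 - x ^ 2) * (1 - y ^ 2) * (1 - z ^ 2)) =
        (‖coneNormal q 1‖ * ‖coneNormal q 2‖) * (‖coneNormal q 2‖ * ‖coneNormal q 0‖) *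
          (‖coneNormal q 0‖ * ‖coneNormal q 1‖) := by
      rw [← n0, ← n1, ← n2]; ring
    rw [e, p]
    have : ∀ a b c r s t : ℂ, -(a * b * c) * (r * s * t) = -((a * r) * (b * s) * (c * t)) := by
      intros; ring
    rw [Complex.ofReal_mul, Complex.ofReal_mul, this, E0, E1, E2, i12, i20, i01, hW]
    push_cast
    have hI : Complex.I ^ 2 = -1 := Complex.I_sq
    have hI3 : Complex.I ^ 3 = - Complex.I := by rw [pow_succ, hI]; ring
    ring_nf
    have hd3 : (d : ℂ) ^ 3 = d * (1 + 2 * (x * y * z) - x ^ 2 - y ^ 2 - z ^ 2) := by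
      rw [pow_succ, hdC]; ring
    simp only [hI, hI3, hdC, hd3]
    ring
  have hW2 : W ^ 2 = (‖W‖ ^ 2 : ℝ) * Complex.exp (((2 * Complex.arg W : ℝ) : ℂ) * Complex.I) := by
    conv_lhs => rw [← Complex.norm_mul_exp_arg_mul_I W]
    rw [mul_pow, ← Complex.exp_nat_mul]
    push_cast
    ring_nf
  have hexp : Complex.exp ((τ : ℂ) * Complex.I) =
      Complex.exp (((2 * Complex.arg W : ℝ) : ℂ) * Complex.I) := by
    rw [hW2, hWn, mul_right_comm (Complex.ofReal _) (Complex.exp _), ← Complex.ofReal_mul] at hexpτ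
    have : 2 * ((1 + x) * (1 + y) * (1 + z)) * ((1 - x) * (1 - y) * (1 - z) / 2) =
        (1 - x ^ 2) * (1 - y ^ 2) * (1 - z ^ 2) := by ring
    rw [this, mul_comm] at hexpτ
    refine mul_left_cancel₀ ?_ hexpτ
    exact Complex.ofReal_ne_zero.2 (mul_pos (mul_pos hx1 hy1) hz1).ne'
  obtain ⟨n, hn⟩ := Complex.exp_eq_exp_iff_exists_int.1 hexp
  have hn' : τ = 2 * Complex.arg W + n * (2 * Real.pi) := by
    have h1 : (τ : ℂ) * Complex.I =
        ((2 * Complex.arg W + n * (2 * Real.pi) : ℝ) : ℂ) * Complex.I := by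
      rw [hn]; push_cast; ring
    exact_mod_cast mul_right_cancel₀ Complex.I_ne_zero h1
  -- τ lies in [0, 2π] and 2 arg W strictly between 0 and 2π, so they differ by less than a full
  -- period.
  have hn1 : (-1 : ℝ) < n := by nlinarith [Real.pi_pos]
  have hn2 : (n : ℝ) < 1 := by nlinarith [Real.pi_pos]
  have hn0 : n = 0 := by
    have h1 : -1 < n := by exact_mod_cast hn1
    have h2 : n < 1 := by exact_mod_cast hn2
    omega
  rw [hn', hn0]; simp

/-! ### The tangent-line bound for triangles with a tetrahedral edge -/

/-- At a fixed determinant, a larger sum of inner products means a smaller solid angle. -/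
lemma arg_le_arg_of_re_le {a b d : ℝ} (hd : 0 < d) (hab : a ≤ b) :
    Complex.arg ((b : ℂ) + d * Complex.I) ≤ Complex.arg ((a : ℂ) + d * Complex.I) := by
  have him (r : ℝ) : ((r : ℂ) + d * Complex.I).im = d := by simp
  have hre (r : ℝ) : ((r : ℂ) + d * Complex.I).re = r := by simp
  have h0 (r : ℝ) : (r : ℂ) + d * Complex.I ≠ 0 := fun h => hd.ne' (by rw [← him r, h]; rfl)
  have hpos (r : ℝ) := norm_pos_iff.2 (h0 r)
  have hnn (r : ℝ) : 0 ≤ Complex.arg ((r : ℂ) + d * Complex.I) :=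
    Complex.arg_nonneg_iff.2 (by rw [him]; exact hd.le)
  by_contra! hcon
  have hs : 0 < Real.sin (Complex.arg ((b : ℂ) + d * Complex.I) -
      Complex.arg ((a : ℂ) + d * Complex.I)) := by
    refine Real.sin_pos_of_pos_of_lt_pi (by linarith) ?_
    have h1 := hnn a
    have h2 : Complex.arg ((b : ℂ) + d * Complex.I) < Real.pi := by
      refine (Complex.arg_le_pi _).lt_of_ne fun h => ?_
      exact hd.ne' (him b ▸ (Complex.arg_eq_pi_iff.1 h).2)
    linarith
  rw [Real.sin_sub, Complex.sin_arg, Complex.sin_arg, Complex.cos_arg (h0 _),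
    Complex.cos_arg (h0 _), him, him, hre, hre] at hs
  have : d / ‖(b : ℂ) + d * Complex.I‖ * (a / ‖(a : ℂ) + d * Complex.I‖) -
      b / ‖(b : ℂ) + d * Complex.I‖ * (d / ‖(a : ℂ) + d * Complex.I‖) =
      d * (a - b) / (‖(b : ℂ) + d * Complex.I‖ * ‖(a : ℂ) + d * Complex.I‖) := by
    field_simp [(hpos a).ne', (hpos b).ne']
  rw [this] at hs
  have : d * (a - b) / (‖(b : ℂ) + d * Complex.I‖ * ‖(a : ℂ) + d * Complex.I‖) ≤ 0 :=
    div_nonpos_of_nonpos_of_nonneg (by nlinarith) (mul_nonneg (hpos b).le (hpos a).le)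
  linarith

lemma hasDerivAt_isoscelesAngle (h : ℝ) (hc : 0 ≤ Real.cos h) :
    HasDerivAt (fun h => Real.arctan (√2 * Real.sin h / (1 + √3 * Real.cos h)))
      (√2 / (Real.cos h + √3)) h := by
  have h3 : 0 < √3 := by positivity
  have hD : 0 < 1 + √3 * Real.cos h := by positivity
  have h1 : HasDerivAt (fun h => √2 * Real.sin h / (1 + √3 * Real.cos h))
      ((√2 * Real.cos h * (1 + √3 * Real.cos h) - √2 * Real.sin h * (√3 * (-Real.sin h))) /
        (1 + √3 * Real.cos h) ^ 2) h :=
    ((Real.hasDerivAt_sin h).const_mul √2).div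
      (((Real.hasDerivAt_cos h).const_mul √3).const_add 1) hD.ne'
  convert h1.arctan using 1
  have s2 : √2 ^ 2 = 2 := Real.sq_sqrt (by norm_num)
  have s3 : √3 ^ 2 = 3 := Real.sq_sqrt (by norm_num)
  have hs : Real.sin h ^ 2 = 1 - Real.cos h ^ 2 := Real.sin_sq h
  have hE : 0 < Real.cos h + √3 := by positivity
  have e1 : √2 * Real.cos h * (1 + √3 * Real.cos h) - √2 * Real.sin h * (√3 * (-Real.sin h)) =
      √2 * (Real.cos h + √3) := by linear_combination √2 * √3 * hs
  have e2 : 1 + (√2 * Real.sin h / (1 + √3 * Real.cos h)) ^ 2 =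
      (Real.cos h + √3) ^ 2 / (1 + √3 * Real.cos h) ^ 2 := by
    rw [div_pow, eq_div_iff (by positivity), add_mul, div_mul_cancel₀ _ (by positivity), mul_pow]
    linear_combination Real.sin h ^ 2 * s2 + 2 * hs + (Real.cos h ^ 2 - 1) * s3
  rw [e1, e2]
  field_simp

/-- The tangent-line bound for isosceles triangles over an edge of the inscribed regular
tetrahedron; equality holds for the triangle of the inscribed cube. -/
lemma isosceles_bound (h : ℝ) (h0 : 0 ≤ h) (h1 : h ≤ Real.pi / 2) :
    √2 / 9 * Real.sin h ≤ 2 / (9 * √3) - 2 * Real.pi / 81 +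
      4 / 27 * Real.arctan (√2 * Real.sin h / (1 + √3 * Real.cos h)) := by
  set f : ℝ → ℝ := fun h => 4 / 27 * Real.arctan (√2 * Real.sin h / (1 + √3 * Real.cos h)) -
    √2 / 9 * Real.sin h with hf
  have s2 : √2 ^ 2 = 2 := Real.sq_sqrt (by norm_num)
  have s3 : √3 ^ 2 = 3 := Real.sq_sqrt (by norm_num)
  have p2 : 0 < √2 := by positivity
  have p3 : 0 < √3 := by positivity
  have hcos {h : ℝ} (hh : h ∈ Set.Icc 0 (Real.pi / 2)) : 0 ≤ Real.cos h :=
    Real.cos_nonneg_of_neg_pi_div_two_le_of_le (by linarith [hh.1, Real.pi_pos]) hh.2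
  have hd {h : ℝ} (hh : h ∈ Set.Icc 0 (Real.pi / 2)) :
      HasDerivAt f (4 / 27 * (√2 / (Real.cos h + √3)) - √2 / 9 * Real.cos h) h :=
    ((hasDerivAt_isoscelesAngle h (hcos hh)).const_mul _).sub
      ((Real.hasDerivAt_sin h).const_mul _)
  -- The elevation of the apex in the triangle of the cube. The slope 4/27 is chosen so that the
  -- derivative of `f` vanishes here; `hfac` shows that it changes sign nowhere else.
  set k := Real.arccos (1 / √3) with hk
  have hi1 : 1 / √3 ≤ 1 := by
    rw [div_le_one p3]; exact Real.le_sqrt_of_sq_le (by norm_num)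
  have hi0 : 0 ≤ 1 / √3 := by positivity
  have hck : Real.cos k = 1 / √3 := Real.cos_arccos (by linarith) hi1
  have hk0 : 0 ≤ k := Real.arccos_nonneg _
  have hk1 : k ≤ Real.pi / 2 := Real.arccos_le_pi_div_two.2 hi0
  have hsk : Real.sin k = √2 / √3 := by
    rw [hk, Real.sin_arccos, div_pow, s3, ← Real.sqrt_div (by norm_num)]; norm_num
  have hfac (c : ℝ) (hc : 0 ≤ c) : 4 / 27 * (√2 / (c + √3)) - √2 / 9 * c =
      √2 / (9 * (c + √3)) * ((1 / √3 - c) * (c + 4 / √3)) := by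
    have : c + √3 ≠ 0 := by positivity
    have e1 : 1 / √3 = √3 / 3 := by field_simp; linarith
    have e2 : 4 / √3 = 4 * √3 / 3 := by field_simp; linarith
    rw [e1, e2]
    field_simp
    linear_combination (-108 : ℝ) * s3
  have hfk : f k = 2 * Real.pi / 81 - 2 / (9 * √3) := by
    have : √2 * Real.sin k / (1 + √3 * Real.cos k) = 1 / √3 := by
      rw [hsk, hck]
      field_simp
      linear_combination s2
    simp only [hf]
    rw [this, hsk, one_div, Real.arctan_inv_sqrt_three]
    field_simp
    linear_combination (-13122 : ℝ) * s2
  have hcont (s : Set ℝ) (hs : s ⊆ Set.Icc 0 (Real.pi / 2)) : ContinuousOn f s := fun x hx =>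
    (hd (hs hx)).continuousAt.continuousWithinAt
  have hmin : f k ≤ f h := by
    rcases le_total h k with hhk | hhk
    · have hsub : Set.Icc 0 k ⊆ Set.Icc 0 (Real.pi / 2) := Set.Icc_subset_Icc_right hk1
      refine antitoneOn_of_deriv_nonpos (convex_Icc 0 k) (hcont _ hsub) (fun x hx => ?_)
        (fun x hx => ?_) ⟨h0, hhk⟩ ⟨hk0, le_rfl⟩ hhk
      · exact (hd (hsub (interior_subset hx))).differentiableAt.differentiableWithinAt
      · have hx' := interior_subset hx
        rw [(hd (hsub hx')).deriv, hfac _ (hcos (hsub hx'))]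
        have hc := hcos (hsub hx')
        have : 1 / √3 ≤ Real.cos x := by
          rw [← hck]
          exact Real.cos_le_cos_of_nonneg_of_le_pi hx'.1 (by linarith [Real.pi_pos]) hx'.2
        refine mul_nonpos_of_nonneg_of_nonpos (by positivity) ?_
        exact mul_nonpos_of_nonpos_of_nonneg (by linarith) (by positivity)
    · have hsub : Set.Icc k (Real.pi / 2) ⊆ Set.Icc 0 (Real.pi / 2) := Set.Icc_subset_Icc_left hk0
      refine monotoneOn_of_deriv_nonneg (convex_Icc k (Real.pi / 2)) (hcont _ hsub) (fun x hx => ?_)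
        (fun x hx => ?_) ⟨le_rfl, hk1⟩ ⟨hhk, h1⟩ hhk
      · exact (hd (hsub (interior_subset hx))).differentiableAt.differentiableWithinAt
      · have hx' := interior_subset hx
        rw [(hd (hsub hx')).deriv, hfac _ (hcos (hsub hx'))]
        have hc := hcos (hsub hx')
        have : Real.cos x ≤ 1 / √3 := by
          rw [← hck]
          exact Real.cos_le_cos_of_nonneg_of_le_pi hk0 (by linarith [Real.pi_pos, hx'.2]) hx'.1
        refine mul_nonneg (by positivity) (mul_nonneg (by linarith) (by positivity))
  rw [hfk] at hmin
  simp only [hf] at hmin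
  linarith

/-- A cone over a triangle with an edge of the inscribed regular tetrahedron has volume bounded
by an affine function of its solid angle. -/
theorem tripleDet_div_six_le (q : Fin 3 → E3) (hq : 0 < tripleDet q) (hn : ∀ i, ‖q i‖ = 1)
    (h01 : ⟪q 0, q 1⟫ = (-1 / 3 : ℝ)) :
    tripleDet q / 6 ≤ 2 / (9 * √3) - 2 * Real.pi / 81 +
      2 / 27 * (4 * Real.pi * ballProb.real (openCone q)) := by
  have hd2 := tripleDet_sq q hn
  rw [solidAngle_eq q hq hn]
  rw [h01] at hd2 ⊢
  set x : ℝ := ⟪q 1, q 2⟫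
  set y : ℝ := ⟪q 2, q 0⟫
  set d := tripleDet q
  have s2 : √2 ^ 2 = 2 := Real.sq_sqrt (by norm_num)
  have s3 : √3 ^ 2 = 3 := Real.sq_sqrt (by norm_num)
  have p2 : 0 < √2 := by positivity
  have p3 : 0 < √3 := by positivity
  -- The cross product of `q 0` and `q 1` has length 2√2/3, so δ is the distance of `q 2` from their
  -- plane and `h` below is its elevation.
  set δ := 3 * d / (2 * √2) with hδ
  have hδ0 : 0 < δ := by positivity
  have hδ2 : δ ^ 2 = 9 * d ^ 2 / 8 := by rw [hδ, div_pow, mul_pow, mul_pow, s2]; ring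
  have hδ1 : δ ≤ 1 := by
    rw [← sq_le_one_iff₀ hδ0.le, hδ2]
    nlinarith [sq_nonneg (x + y / 3), sq_nonneg y]
  set h := Real.arcsin δ
  have hsin : Real.sin h = δ := Real.sin_arcsin (by linarith) hδ1
  have hh0 : 0 ≤ h := Real.arcsin_nonneg.2 hδ0.le
  have hh1 : h ≤ Real.pi / 2 := Real.arcsin_le_pi_div_two δ
  have hc0 : 0 ≤ Real.cos h := Real.cos_arcsin_nonneg δ
  have hc2 : Real.cos h ^ 2 = 1 - δ ^ 2 := by rw [← hsin]; exact Real.cos_sq' h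
  have hb := isosceles_bound h hh0 hh1
  -- At a given elevation x + y is largest in the isosceles case x = y: the squares of the two sides
  -- differ by (x - y)²/2.
  have hxy : x + y ≤ 2 / √3 * Real.cos h := by
    refine le_of_sq_le_sq ?_ (by positivity)
    rw [mul_pow, div_pow, s3, hc2, hδ2, hd2]
    nlinarith [sq_nonneg (x - y)]
  have hD : 1 + x + y + (-1 / 3) ≤ 2 / 3 * (1 + √3 * Real.cos h) := by
    have : 2 / 3 * (1 + √3 * Real.cos h) = 2 / 3 + 2 / √3 * Real.cos h := by
      field_simp
      linear_combination Real.cos h * s3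
    linarith
  have harg := arg_le_arg_of_re_le hq hD
  have harg' : Complex.arg (((2 / 3 * (1 + √3 * Real.cos h) : ℝ) : ℂ) + d * Complex.I) =
      Real.arctan (√2 * Real.sin h / (1 + √3 * Real.cos h)) := by
    have hpos : 0 < 2 / 3 * (1 + √3 * Real.cos h) := by positivity
    set Z : ℂ := ((2 / 3 * (1 + √3 * Real.cos h) : ℝ) : ℂ) + d * Complex.I with hZ
    have hre : Z.re = 2 / 3 * (1 + √3 * Real.cos h) := by
      rw [hZ, Complex.add_re, Complex.ofReal_re, Complex.re_ofReal_mul, Complex.I_re, mul_zero,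
        add_zero]
    have him : Z.im = d := by simp [hZ]
    have habs := Complex.abs_arg_lt_pi_div_two_iff.2 (Or.inl (hre ▸ hpos))
    rw [← Real.arctan_tan (abs_lt.1 habs).1 (abs_lt.1 habs).2, Complex.tan_arg, hre, him, hsin, hδ]
    congr 1
    have : 1 + √3 * Real.cos h ≠ 0 := by positivity
    field_simp
  have : √2 / 9 * Real.sin h = d / 6 := by
    rw [hsin, hδ]; field_simp; norm_num
  rw [harg'] at harg
  linarith

/-! ### Triangulating the boundary of a polytope by a generic lifting -/

lemma injective_of_tripleDet_pos {ι : Type*} {p : ι → E3} {F : Fin 3 → ι}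
    (hF : 0 < tripleDet (p ∘ F)) : Function.Injective F := by
  intro i j hij
  by_contra hne
  have h1 := inner_coneNormal_self (p ∘ F) i
  have h2 := inner_coneNormal_of_ne (p ∘ F) (m := i) (k := j) (Ne.symm hne)
  simp only [Function.comp_apply, hij] at h1 h2
  rw [h2] at h1
  exact hF.ne h1

lemma tripleDet_ne_zero {q : Fin 3 → E3} (hq : LinearIndependent ℝ q) : tripleDet q ≠ 0 := by
  let A : Matrix (Fin 3) (Fin 3) ℝ := Matrix.of fun i j => q i j
  have hA : LinearIndependent ℝ A.row := by
    have := hq.map' (WithLp.linearEquiv 2 ℝ (Fin 3 → ℝ)).toLinearMap (LinearEquiv.ker _)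
    exact this
  have hdet : A.det = tripleDet q := by
    rw [Matrix.det_fin_three]
    simp [A, tripleDet, inner_E3, crossE]
    ring
  rw [← hdet]
  exact ((Matrix.isUnit_iff_isUnit_det A).1 (Matrix.linearIndependent_rows_iff_isUnit.1 hA)).ne_zero

section Lift

variable {n : ℕ} (p : Fin n → E3)

/-- The height of the lifted point `l` above the hyperplane through the lifted points of the
triple `F`, scaled by the determinant of the triple, as a linear function of the lifting. -/
noncomputable def liftGap (F : Fin 3 → Fin n) (l : Fin n) : (Fin n → ℝ) →ₗ[ℝ] ℝ :=
  tripleDet (p ∘ F) • LinearMap.proj l -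
    ∑ m, ⟪coneNormal (p ∘ F) m, p l⟫ • LinearMap.proj (F m)

/-- The functional equal to `tripleDet * w` on the triple `F`. -/
noncomputable def liftFunctional (w : Fin n → ℝ) (F : Fin 3 → Fin n) : E3 :=
  ∑ m, w (F m) • coneNormal (p ∘ F) m

lemma inner_liftFunctional (w : Fin n → ℝ) (F : Fin 3 → Fin n) (x : E3) :
    ⟪liftFunctional p w F, x⟫ = ∑ m, w (F m) * ⟪coneNormal (p ∘ F) m, x⟫ := by
  simp [liftFunctional, sum_inner, real_inner_smul_left]

lemma liftGap_apply (w : Fin n → ℝ) (F : Fin 3 → Fin n) (l : Fin n) :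
    liftGap p F l w = w l * tripleDet (p ∘ F) - ⟪liftFunctional p w F, p l⟫ := by
  simp [inner_liftFunctional, liftGap, mul_comm]

lemma liftGap_self (w : Fin n → ℝ) (F : Fin 3 → Fin n) (m : Fin 3) :
    liftGap p F (F m) w = 0 := by
  rw [liftGap_apply, inner_liftFunctional, Finset.sum_eq_single m]
  · rw [← inner_coneNormal_self (p ∘ F) m]; simp
  · intro k _ hk
    have := inner_coneNormal_of_ne (p ∘ F) (m := k) (k := m) hk.symm
    simp only [Function.comp_apply] at this
    rw [this, mul_zero]
  · simp

lemma liftGap_ne_zero (F : Fin 3 → Fin n) (hF : 0 < tripleDet (p ∘ F)) (l : Fin n)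
    (hl : l ∉ Set.range F) : liftGap p F l ≠ 0 := by
  intro h
  have h1 : liftGap p F l (Pi.single l 1) = tripleDet (p ∘ F) := by
    rw [liftGap_apply, inner_liftFunctional, Finset.sum_eq_zero]
    · simp
    · intro m _
      rw [Pi.single_eq_of_ne (fun hm => hl ⟨m, hm⟩), zero_mul]
  rw [h] at h1
  exact hF.ne h1

/-- Each degenerate coincidence confines `w` to a proper subspace, hence to a null set. A strictly
negative gap at the constant lifting 1 stays negative nearby; so a triple that supports the lifting
`w` also supports the original polytope. -/
lemma exists_generic_lift : ∃ w : Fin n → ℝ, (∀ i, 0 < w i) ∧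
    ∀ F : Fin 3 → Fin n, 0 < tripleDet (p ∘ F) → ∀ l,
      (l ∉ Set.range F → liftGap p F l w ≠ 0) ∧
      (0 ≤ liftGap p F l w → 0 ≤ liftGap p F l 1) := by
  have hdense : Dense {w : Fin n → ℝ | ∀ F : Fin 3 → Fin n, ∀ l,
      0 < tripleDet (p ∘ F) → l ∉ Set.range F → liftGap p F l w ≠ 0} := by
    refine Measure.dense_of_ae (μ := volume) ?_
    refine ae_all_iff.2 fun F => ae_all_iff.2 fun l => ?_
    by_cases h : 0 < tripleDet (p ∘ F) ∧ l ∉ Set.range F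
    · have := Measure.addHaar_submodule volume (LinearMap.ker (liftGap p F l)) (by
        rw [Ne, LinearMap.ker_eq_top]; exact liftGap_ne_zero p F h.1 l h.2)
      filter_upwards [measure_eq_zero_iff_ae_notMem.1 this] with w hw _ _
      simpa using hw
    · filter_upwards with w h1 h2 using absurd ⟨h1, h2⟩ h
  have hopen : IsOpen {w : Fin n → ℝ | (∀ i, 0 < w i) ∧
      ∀ F : Fin 3 → Fin n, ∀ l, liftGap p F l 1 < 0 → liftGap p F l w < 0} := by
    have : {w : Fin n → ℝ | (∀ i, 0 < w i) ∧
        ∀ F : Fin 3 → Fin n, ∀ l, liftGap p F l 1 < 0 → liftGap p F l w < 0} =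
        (⋂ i, {w | 0 < w i}) ∩ ⋂ (F : Fin 3 → Fin n), ⋂ l, ⋂ _ : liftGap p F l 1 < 0,
          {w | liftGap p F l w < 0} := by ext; simp
    rw [this]
    refine (isOpen_iInter_of_finite fun i =>
      isOpen_lt continuous_const (continuous_apply i)).inter
      (isOpen_iInter_of_finite fun F => isOpen_iInter_of_finite fun l =>
        isOpen_iInter_of_finite fun _ => ?_)
    exact isOpen_lt (LinearMap.continuous_of_finiteDimensional _) continuous_const
  obtain ⟨w, hw1, hw2⟩ := hdense.inter_open_nonempty _ hopen
    ⟨1, fun i => one_pos, fun F l h => h⟩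
  refine ⟨w, hw1.1, fun F hF l => ⟨hw2 F l hF, fun h => ?_⟩⟩
  by_contra! hcon
  linarith [hw1.2 F l hcon]

/-- A canonically ordered triple spanning a facet of the lower hull of the lifted points. -/
def IsLiftFacet (w : Fin n → ℝ) (F : Fin 3 → Fin n) : Prop :=
  (F 0 < F 1 ∧ F 0 < F 2) ∧ 0 < tripleDet (p ∘ F) ∧ ∀ l, l ∉ Set.range F → 0 < liftGap p F l w

variable {p}

lemma IsLiftFacet.liftGap_nonneg {w : Fin n → ℝ} {F : Fin 3 → Fin n} (h : IsLiftFacet p w F)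
    (l : Fin n) : 0 ≤ liftGap p F l w := by
  by_cases hl : l ∈ Set.range F
  · obtain ⟨m, rfl⟩ := hl
    exact (liftGap_self p w F m).ge
  · exact (h.2.2 l hl).le

/-- Expand det(F) · x in the vectors of `F` and compare, at each of them, the functional of `G` with
`w`. -/
lemma liftFunctional_exchange (w : Fin n → ℝ) (F G : Fin 3 → Fin n) (x : E3) :
    tripleDet (p ∘ F) * ⟪liftFunctional p w G, x⟫ +
      ∑ m, ⟪coneNormal (p ∘ F) m, x⟫ * liftGap p G (F m) w =
    tripleDet (p ∘ G) * ⟪liftFunctional p w F, x⟫ := by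
  have h1 : tripleDet (p ∘ F) * ⟪liftFunctional p w G, x⟫ =
      ∑ m, ⟪coneNormal (p ∘ F) m, x⟫ * ⟪liftFunctional p w G, p (F m)⟫ := by
    rw [← inner_smul_right, tripleDet_smul_eq_sum, inner_sum]
    simp [inner_smul_right]
  rw [h1, ← Finset.sum_add_distrib, inner_liftFunctional, Finset.mul_sum]
  refine Finset.sum_congr rfl fun m _ => ?_
  rw [liftGap_apply]; ring

/-- The exchange identity in both directions makes two nonnegative sums add up to zero; a vertex of
`F` outside `G` would contribute a positive term. -/
lemma IsLiftFacet.range_subset {w : Fin n → ℝ} {F G : Fin 3 → Fin n} (hF : IsLiftFacet p w F)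
    (hG : IsLiftFacet p w G) {x : E3} (hxF : x ∈ openCone (p ∘ F)) (hxG : x ∈ openCone (p ∘ G))
    (m : Fin 3) : F m ∈ Set.range G := by
  have e1 := liftFunctional_exchange (p := p) w F G x
  have e2 := liftFunctional_exchange (p := p) w G F x
  have p1 : ∀ m ∈ Finset.univ, 0 ≤ ⟪coneNormal (p ∘ F) m, x⟫ * liftGap p G (F m) w := fun m _ =>
    mul_nonneg (hxF m).le (hG.liftGap_nonneg _)
  have p2 : ∀ m ∈ Finset.univ, 0 ≤ ⟪coneNormal (p ∘ G) m, x⟫ * liftGap p F (G m) w := fun m _ =>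
    mul_nonneg (hxG m).le (hF.liftGap_nonneg _)
  have s1 := Finset.sum_nonneg p1
  have s2 := Finset.sum_nonneg p2
  have h0 : ∑ m, ⟪coneNormal (p ∘ F) m, x⟫ * liftGap p G (F m) w = 0 := by linarith
  have h1 := (Finset.sum_eq_zero_iff_of_nonneg p1).1 h0 m (Finset.mem_univ m)
  by_contra hcon
  exact (mul_pos (hxF m) (hG.2.2 _ hcon)).ne' h1

/-- The index sets agree and the least index comes first, so only a swap of the last two entries is
possible; it would reverse the orientation. -/
lemma IsLiftFacet.eq_of_mem {w : Fin n → ℝ} {F G : Fin 3 → Fin n} (hF : IsLiftFacet p w F)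
    (hG : IsLiftFacet p w G) {x : E3} (hxF : x ∈ openCone (p ∘ F)) (hxG : x ∈ openCone (p ∘ G)) :
    F = G := by
  have hFG := hF.range_subset hG hxF hxG
  have hGF := hG.range_subset hF hxG hxF
  have iF := injective_of_tripleDet_pos hF.2.1
  have iG := injective_of_tripleDet_pos hG.2.1
  have F12 : F 1 ≠ F 2 := iF.ne (by decide)
  have G12 : G 1 ≠ G 2 := iG.ne (by decide)
  obtain ⟨⟨a1, a2⟩, hdF, -⟩ := hF
  obtain ⟨⟨b1, b2⟩, hdG, -⟩ := hG
  obtain ⟨k0, e0⟩ := hFG 0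
  obtain ⟨k1, e1⟩ := hFG 1
  obtain ⟨k2, e2⟩ := hFG 2
  obtain ⟨j0, f0⟩ := hGF 0
  have h00 : F 0 = G 0 := by
    have u1 : G 0 ≤ F 0 := by
      rw [← e0]; fin_cases k0 <;> [exact le_rfl; exact b1.le; exact b2.le]
    have u2 : F 0 ≤ G 0 := by
      rw [← f0]; fin_cases j0 <;> [exact le_rfl; exact a1.le; exact a2.le]
    exact le_antisymm u2 u1
  have hk1 : k1 ≠ 0 := by rintro rfl; rw [← h00] at e1; exact a1.ne e1
  have hk2 : k2 ≠ 0 := by rintro rfl; rw [← h00] at e2; exact a2.ne e2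
  have hk12 : k1 ≠ k2 := by rintro rfl; exact F12 (e1.symm.trans e2)
  have hcase : (k1 = 1 ∧ k2 = 2) ∨ (k1 = 2 ∧ k2 = 1) := by
    fin_cases k1 <;> fin_cases k2 <;> simp_all
  rcases hcase with ⟨rfl, rfl⟩ | ⟨rfl, rfl⟩
  · funext m; fin_cases m <;> [exact h00; exact e1.symm; exact e2.symm]
  · exfalso
    have : p ∘ G = ![(p ∘ F) 0, (p ∘ F) 2, (p ∘ F) 1] := by
      funext m; fin_cases m <;> simp [h00, e1, e2]
    rw [this, tripleDet_swap] at hdG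
    linarith

/-- A ball around the origin inside the hull bounds its support function from below. -/
lemma exists_inner_ge (h0 : (0 : E3) ∈ interior (convexHull ℝ (Set.range p))) :
    ∃ δ > 0, ∀ y : E3, ∃ i, δ * ‖y‖ ≤ ⟪y, p i⟫ := by
  obtain ⟨δ, hδ, hball⟩ := Metric.isOpen_iff.1 isOpen_interior 0 h0
  refine ⟨δ / 2, by positivity, fun y => ?_⟩
  by_contra! hcon
  have hsub : convexHull ℝ (Set.range p) ⊆ {x | innerₛₗ ℝ y x < δ / 2 * ‖y‖} := by
    refine convexHull_min ?_ (convex_halfSpace_lt (innerₛₗ ℝ y).isLinear _)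
    rintro _ ⟨i, rfl⟩
    exact hcon i
  by_cases hy : y = 0
  · have := hsub (interior_subset h0)
    simp [hy] at this
  · have hy' : 0 < ‖y‖ := norm_pos_iff.2 hy
    have hz : (δ / 2 / ‖y‖) • y ∈ Metric.ball (0 : E3) δ := by
      rw [mem_ball_zero_iff, norm_smul, Real.norm_of_nonneg (by positivity),
        div_mul_cancel₀ _ hy'.ne']
      linarith
    have := hsub (interior_subset (hball hz))
    simp only [Set.mem_ofPred_eq, innerₛₗ_apply_apply, inner_smul_right,
      real_inner_self_eq_norm_sq] at this
    have e : δ / 2 / ‖y‖ * ‖y‖ ^ 2 = δ / 2 * ‖y‖ := by field_simp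
    linarith

lemma zero_mem_interior_scaled (h0 : (0 : E3) ∈ interior (convexHull ℝ (Set.range p)))
    (w : Fin n → ℝ) (hw : ∀ i, 0 < w i) :
    (0 : E3) ∈ interior (convexHull ℝ (Set.range fun i => (w i)⁻¹ • p i)) := by
  obtain ⟨δ, hδ, hy⟩ := exists_inner_ge h0
  obtain ⟨W, hW⟩ := (Set.finite_range w).bddAbove
  have hW' : ∀ i, w i ≤ W := fun i => hW ⟨i, rfl⟩
  obtain ⟨i0, -⟩ := hy 0
  have hWpos : 0 < W := (hw i0).trans_le (hW' i0)
  refine mem_interior.2 ⟨Metric.ball 0 (δ / W), fun z hz => ?_, Metric.isOpen_ball,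
    Metric.mem_ball_self (by positivity)⟩
  by_contra hcon
  obtain ⟨f, u, hf1, hf2⟩ := geometric_hahn_banach_closed_point
    (convex_convexHull ℝ (Set.range fun i => (w i)⁻¹ • p i))
    ((Set.finite_range _).isClosed_convexHull ℝ) hcon
  set y := (InnerProductSpace.toDual ℝ E3).symm f with hyf
  have hfy (x : E3) : f x = ⟪y, x⟫ := by simp [hyf]
  obtain ⟨i, hi⟩ := hy y
  have h1 := hf1 _ (subset_convexHull ℝ _ ⟨i, rfl⟩)
  simp only [hfy, inner_smul_right] at h1 hf2
  have h2 : δ / W * ‖y‖ ≤ (w i)⁻¹ * ⟪y, p i⟫ := by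
    calc δ / W * ‖y‖ = W⁻¹ * (δ * ‖y‖) := by ring
      _ ≤ (w i)⁻¹ * (δ * ‖y‖) := by
          gcongr
          · exact hw i
          · exact hW' i
      _ ≤ _ := mul_le_mul_of_nonneg_left hi (inv_nonneg.2 (hw i).le)
  have h3 := real_inner_le_norm y z
  rw [mem_ball_zero_iff] at hz
  nlinarith [norm_nonneg y]

/-- The gauge rescales `x` to the boundary, where Hahn–Banach supplies a supporting plane; it misses
the origin. -/
lemma exists_supporting_functional (h0 : (0 : E3) ∈ interior (convexHull ℝ (Set.range p)))
    (x : E3) (hx : x ≠ 0) :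
    ∃ g > (0 : ℝ), g • x ∈ convexHull ℝ (Set.range p) ∧ ∃ y : E3, 0 < ⟪y, g • x⟫ ∧
      ∀ i, ⟪y, p i⟫ ≤ ⟪y, g • x⟫ := by
  set P := convexHull ℝ (Set.range p) with hP
  have hcv : Convex ℝ P := convex_convexHull ℝ _
  have hcomp : IsCompact P := (Set.finite_range p).isCompact_convexHull ℝ
  have hnhds : P ∈ nhds (0 : E3) := mem_interior_iff_mem_nhds.1 h0
  have hg : 0 < gauge P x :=
    (gauge_pos (absorbent_nhds_zero hnhds) (hcomp.isVonNBounded ℝ)).2 hx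
  have hg1 : gauge P ((gauge P x)⁻¹ • x) = 1 := by
    rw [gauge_smul_of_nonneg (inv_nonneg.2 hg.le), smul_eq_mul, inv_mul_cancel₀ hg.ne']
  have hfr := (gauge_eq_one_iff_mem_frontier hcv hnhds).1 hg1
  set x' := (gauge P x)⁻¹ • x
  refine ⟨(gauge P x)⁻¹, inv_pos.2 hg, hcomp.isClosed.frontier_subset hfr, ?_⟩
  obtain ⟨f, hf⟩ := geometric_hahn_banach_open_point hcv.interior isOpen_interior hfr.2
  have hcl : P ⊆ closure (interior P) := by
    rw [hcv.closure_interior_eq_closure_of_nonempty_interior ⟨0, h0⟩]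
    exact subset_closure
  have hle : ∀ a ∈ P, f a ≤ f x' := fun a ha =>
    closure_minimal (fun b hb => (hf b hb).le) (isClosed_le f.continuous continuous_const) (hcl ha)
  set y := (InnerProductSpace.toDual ℝ E3).symm f with hyf
  have hfy (x : E3) : f x = ⟪y, x⟫ := by simp [hyf]
  refine ⟨y, ?_, fun i => ?_⟩
  · rw [← hfy]; simpa only [map_zero] using hf 0 h0
  · rw [← hfy, ← hfy]; exact hle _ (subset_convexHull ℝ _ ⟨i, rfl⟩)

lemma ae_notMem_span_pair (p : Fin n → E3) : ∀ᵐ x : E3, ∀ s : Finset (Fin n), s.card ≤ 2 →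
    x ∉ Submodule.span ℝ (p '' s) := by
  refine ae_all_iff.2 fun s => ?_
  by_cases hs : s.card ≤ 2
  · have := Measure.addHaar_submodule (volume : Measure E3) (Submodule.span ℝ (p '' s)) (by
      intro htop
      have h1 := finrank_span_finset_le_card (R := ℝ) (s.image p)
      rw [Finset.coe_image, Set.finrank, htop, finrank_top] at h1
      have h2 : (s.image p).card ≤ s.card := Finset.card_image_le
      simp at h1
      omega)
    filter_upwards [measure_eq_zero_iff_ae_notMem.1 this] with x hx _ using hx
  · filter_upwards with x h using absurd h hs

lemma exists_canonical_perm (F : Fin 3 → Fin n) (hF : Function.Injective F)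
    (hd : tripleDet (p ∘ F) ≠ 0) : ∃ π : Equiv.Perm (Fin 3),
      ((F ∘ π) 0 < (F ∘ π) 1 ∧ (F ∘ π) 0 < (F ∘ π) 2) ∧ 0 < tripleDet (p ∘ (F ∘ π)) := by
  obtain ⟨k, -, hk⟩ := Finset.exists_min_image Finset.univ F Finset.univ_nonempty
  have hlt (m : Fin 3) (hm : m ≠ k) : F k < F m :=
    (hk m (Finset.mem_univ m)).lt_of_ne (hF.ne hm.symm)
  have hrot : tripleDet (p ∘ (F ∘ Equiv.addRight k)) = tripleDet (p ∘ F) :=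
    tripleDet_rotate (p ∘ F) k
  rcases hd.lt_or_gt with h | h
  · refine ⟨(Equiv.swap 1 2).trans (Equiv.addRight k), ⟨?_, ?_⟩, ?_⟩
    · simpa [Equiv.swap_apply_of_ne_of_ne] using hlt (2 + k) (by fin_cases k <;> decide)
    · simpa [Equiv.swap_apply_of_ne_of_ne] using hlt (1 + k) (by fin_cases k <;> decide)
    · have : p ∘ (F ∘ ((Equiv.swap 1 2).trans (Equiv.addRight k))) =
          ![(p ∘ (F ∘ Equiv.addRight k)) 0, (p ∘ (F ∘ Equiv.addRight k)) 2,
            (p ∘ (F ∘ Equiv.addRight k)) 1] := by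
        funext m; fin_cases m <;> simp [Equiv.swap_apply_of_ne_of_ne]
      rw [this, tripleDet_swap, hrot]
      linarith
  · refine ⟨Equiv.addRight k, ⟨?_, ?_⟩, by rw [hrot]; exact h⟩
    · simpa [Equiv.swap_apply_of_ne_of_ne] using hlt (1 + k) (by fin_cases k <;> decide)
    · simpa [Equiv.swap_apply_of_ne_of_ne] using hlt (2 + k) (by fin_cases k <;> decide)

lemma mem_openCone_of_eq_sum {q : Fin 3 → E3} (hq : 0 < tripleDet q) {c : Fin 3 → ℝ}
    (hc : ∀ m, 0 < c m) : ∑ m, c m • q m ∈ openCone q := by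
  intro m
  rw [inner_sum, Finset.sum_eq_single m]
  · rw [inner_smul_right, inner_coneNormal_self]
    exact mul_pos (hc m) hq
  · intro k _ hk
    rw [inner_smul_right, inner_coneNormal_of_ne q hk, mul_zero]
  · simp

/-- The lift facets are the facets of the hull of the points `p i / w i`. The ray through a generic
`x` leaves this hull inside a facet, whose vertices are found by Carathéodory's theorem. -/
lemma ae_exists_isLiftFacet (h0 : (0 : E3) ∈ interior (convexHull ℝ (Set.range p)))
    (w : Fin n → ℝ) (hw : ∀ i, 0 < w i)
    (hgen : ∀ F : Fin 3 → Fin n, 0 < tripleDet (p ∘ F) → ∀ l, l ∉ Set.range F →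
      liftGap p F l w ≠ 0) :
    ∀ᵐ x : E3, ∃ F, IsLiftFacet p w F ∧ x ∈ openCone (p ∘ F) := by
  filter_upwards [ae_notMem_span_pair p] with x hx
  have hx0 : x ≠ 0 := by
    rintro rfl
    exact hx ∅ (by simp) (Submodule.zero_mem _)
  obtain ⟨g, hg, hmem, y, hy0, hy⟩ :=
    exists_supporting_functional (zero_mem_interior_scaled h0 w hw) x hx0
  set M := ⟪y, g • x⟫
  obtain ⟨ι, _, z, ω, hz, haff, hω, hω1, hsum⟩ := eq_pos_convex_span_of_mem_convexHull hmem
  have hz' : ∀ k, ∃ i, (w i)⁻¹ • p i = z k := fun k => hz ⟨k, rfl⟩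
  choose σ hσ using hz'
  have hpz (k : ι) : p (σ k) = w (σ k) • z k := by
    rw [← hσ k, smul_smul, mul_inv_cancel₀ (hw _).ne', one_smul]
  have hle (k : ι) : ⟪y, z k⟫ ≤ M := by rw [← hσ k]; exact hy _
  -- A convex combination with positive weights reaches the maximum only if every term does.
  have hM (k : ι) : ⟪y, z k⟫ = M := by
    have h1 : ∑ k, ω k * (M - ⟪y, z k⟫) = 0 := by
      simp only [mul_sub, Finset.sum_sub_distrib, ← Finset.sum_mul, hω1]
      have : M = ∑ k, ω k * ⟪y, z k⟫ := by
        change ⟪y, g • x⟫ = _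
        rw [← hsum, inner_sum]; simp [inner_smul_right]
      rw [← this]; ring
    have h2 := (Finset.sum_eq_zero_iff_of_nonneg (fun k _ =>
      mul_nonneg (hω k).le (sub_nonneg.2 (hle k)))).1 h1 k (Finset.mem_univ k)
    rcases mul_eq_zero.1 h2 with h | h
    · exact absurd h (hω k).ne'
    · linarith
  -- The points lie in a plane missing the origin, so affine independence becomes linear.
  have hli : LinearIndependent ℝ z := by
    refine Fintype.linearIndependent_iff.2 fun c hc => ?_
    have hcs : ∑ k, c k = 0 := by
      have h1 : ⟪y, ∑ k, c k • z k⟫ = (0 : ℝ) := by rw [hc, inner_zero_right]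
      rw [inner_sum] at h1
      simp only [inner_smul_right, hM, ← Finset.sum_mul] at h1
      exact (mul_eq_zero.1 h1).resolve_right hy0.ne'
    intro k
    exact (affineIndependent_iff.1 haff) Finset.univ c hcs hc k (Finset.mem_univ k)
  -- With fewer points `x` would lie in one of the excluded spans.
  have hcard : Fintype.card ι = 3 := by
    have h1 : Fintype.card ι ≤ 3 := by simpa using hli.fintype_card_le_finrank
    by_contra hne
    refine hx (Finset.univ.image σ) (Finset.card_image_le.trans ?_) ?_
    · rw [Finset.card_univ]; omega
    · have : x = g⁻¹ • ∑ k, ω k • z k := by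
        rw [hsum, smul_smul, inv_mul_cancel₀ hg.ne', one_smul]
      rw [this]
      refine Submodule.smul_mem _ _ (Submodule.sum_mem _ fun k _ => Submodule.smul_mem _ _ ?_)
      rw [← hσ k]
      refine Submodule.smul_mem _ _ (Submodule.subset_span ⟨σ k, by simp, rfl⟩)
  let e : Fin 3 ≃ ι := (Fintype.equivFinOfCardEq hcard).symm
  have hli' : LinearIndependent ℝ (p ∘ (σ ∘ e)) := by
    have h1 := (hli.comp e e.injective).units_smul
      (fun m => Units.mk0 (w (σ (e m))) (hw _).ne')
    convert h1 using 1
    funext m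
    simp only [Function.comp_apply, hpz]
    rfl
  obtain ⟨π, hπ, hπd⟩ := exists_canonical_perm (σ ∘ e)
    (Function.Injective.of_comp (f := p) hli'.injective) (tripleDet_ne_zero hli')
  set F : Fin 3 → Fin n := (σ ∘ e) ∘ π with hF
  let τ : Fin 3 ≃ ι := π.trans e
  have hFτ (m : Fin 3) : F m = σ (τ m) := rfl
  refine ⟨F, ⟨hπ, hπd, fun l hl => ?_⟩, ?_⟩
  · refine lt_of_le_of_ne ?_ (hgen F hπd l hl).symm
    have hyF (m : Fin 3) : ⟪y, p (F m)⟫ = w (F m) * M := by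
      rw [hFτ, hpz, inner_smul_right, hM]
    have h1 : tripleDet (p ∘ F) * ⟪y, p l⟫ = M * ⟪liftFunctional p w F, p l⟫ := by
      rw [← inner_smul_right, tripleDet_smul_eq_sum, inner_sum, inner_liftFunctional,
        Finset.mul_sum]
      refine Finset.sum_congr rfl fun m _ => ?_
      rw [inner_smul_right, Function.comp_apply, hyF]; ring
    have h2 : ⟪y, p l⟫ ≤ M * w l := by
      have := hy l
      rw [inner_smul_right, inv_mul_le_iff₀ (hw l)] at this
      linarith
    have h3 : 0 ≤ M * liftGap p F l w := by
      rw [liftGap_apply, mul_sub, ← h1]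
      nlinarith
    exact nonneg_of_mul_nonneg_right h3 hy0
  · have : x = ∑ m, (g⁻¹ * ω (τ m) * (w (F m))⁻¹) • (p ∘ F) m := by
      have h1 : x = g⁻¹ • ∑ k, ω k • z k := by
        rw [hsum, smul_smul, inv_mul_cancel₀ hg.ne', one_smul]
      rw [h1, ← Equiv.sum_comp τ, Finset.smul_sum]
      refine Finset.sum_congr rfl fun m _ => ?_
      rw [Function.comp_apply, hFτ, ← hσ (τ m), smul_smul, smul_smul]
    rw [this]
    exact mem_openCone_of_eq_sum hπd fun m =>
      mul_pos (mul_pos (inv_pos.2 hg) (hω _)) (inv_pos.2 (hw _))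

/-- The boundary of a polytope around the origin has a triangulation without new vertices. -/
theorem exists_boundary_triangulation (p : Fin n → E3)
    (h0 : (0 : E3) ∈ interior (convexHull ℝ (Set.range p))) :
    ∃ T : Finset (Fin 3 → Fin n), (∀ F ∈ T, 0 < tripleDet (p ∘ F)) ∧
      (∀ F ∈ T, ∀ l, ∑ m, ⟪coneNormal (p ∘ F) m, p l⟫ ≤ tripleDet (p ∘ F)) ∧
      (∀ F ∈ T, ∀ G ∈ T, ∀ x, x ∈ openCone (p ∘ F) → x ∈ openCone (p ∘ G) → F = G) ∧
      ∀ᵐ x : E3, ∃ F ∈ T, x ∈ openCone (p ∘ F) := by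
  classical
  obtain ⟨w, hw, hgen⟩ := exists_generic_lift p
  refine ⟨Finset.univ.filter (IsLiftFacet p w), ?_, ?_, ?_, ?_⟩
  · intro F hF
    exact (Finset.mem_filter.1 hF).2.2.1
  · intro F hF l
    have hF' := (Finset.mem_filter.1 hF).2
    have := (hgen F hF'.2.1 l).2 (hF'.liftGap_nonneg l)
    rw [liftGap_apply, inner_liftFunctional] at this
    simp only [Pi.one_apply, one_mul] at this
    linarith
  · intro F hF G hG x hxF hxG
    exact (Finset.mem_filter.1 hF).2.eq_of_mem (Finset.mem_filter.1 hG).2 hxF hxG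
  · filter_upwards [ae_exists_isLiftFacet h0 w hw fun F hF l => (hgen F hF l).1] with x hx
    obtain ⟨F, hF, hxF⟩ := hx
    exact ⟨F, by simpa using hF, hxF⟩

end Lift

/-! ### Counting triangles by angle sums -/

/-- Moving slightly from an edge of a cone into the wedge at that edge leads into the cone. -/
lemma exists_mem_openCone_of_mem_edgeWedge {q : Fin 3 → E3} (hq : 0 < tripleDet q) {m : Fin 3}
    {x : E3} (hx : x ∈ edgeWedge q m) :
    ∀ᶠ ε : ℝ in nhdsWithin 0 (Set.Ioi 0), q m + ε • x ∈ openCone q := by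
  have hpos : ∀ᶠ ε : ℝ in nhdsWithin 0 (Set.Ioi 0), 0 < ε := self_mem_nhdsWithin
  have hc : Filter.Tendsto (fun ε : ℝ => tripleDet q + ε * ⟪coneNormal q m, x⟫)
      (nhdsWithin 0 (Set.Ioi 0)) (nhds (tripleDet q)) := by
    have : Continuous fun ε : ℝ => tripleDet q + ε * ⟪coneNormal q m, x⟫ := by fun_prop
    have h := this.tendsto 0
    simp only [zero_mul, add_zero] at h
    exact h.mono_left nhdsWithin_le_nhds
  filter_upwards [hpos, hc.eventually (lt_mem_nhds hq)] with ε hε h1 k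
  rw [inner_add_right, inner_smul_right]
  by_cases hk : k = m
  · subst hk
    rwa [inner_coneNormal_self]
  · rw [inner_coneNormal_of_ne q (Ne.symm hk), zero_add]
    refine mul_pos hε ?_
    have : k = m + 1 ∨ k = m + 2 := by
      revert hk; fin_cases k <;> fin_cases m <;> decide
    rcases this with rfl | rfl
    · exact hx.1
    · exact hx.2

section Triangulation

variable {n : ℕ} {p : Fin n → E3} {T : Finset (Fin 3 → Fin n)}

lemma sum_ballProb_openCone
    (hdisj : ∀ F ∈ T, ∀ G ∈ T, ∀ x, x ∈ openCone (p ∘ F) → x ∈ openCone (p ∘ G) → F = G)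
    (hcov : ∀ᵐ x : E3, ∃ F ∈ T, x ∈ openCone (p ∘ F)) :
    ∑ F ∈ T, ballProb.real (openCone (p ∘ F)) = 1 := by
  rw [← measureReal_biUnion_finset]
  · rw [← probReal_univ (μ := ballProb)]
    refine measureReal_congr (Filter.eventuallyEq_univ.2 ?_)
    filter_upwards [ballProb_absolutelyContinuous.ae_le hcov] with x hx
    simpa using hx
  · intro F hF G hG hne
    rw [Function.onFun, Set.disjoint_left]
    exact fun x h1 h2 => hne (hdisj F hF G hG x h1 h2)
  · exact fun F _ => (isOpen_openCone _).measurableSet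

/-- Dihedral wedges of different triangles at a common vertex are disjoint, since a common direction
would lead from the vertex into both cones. Each vertex thus contributes at most a full turn. -/
lemma sum_ballProb_edgeWedge_le (hdet : ∀ F ∈ T, 0 < tripleDet (p ∘ F))
    (hdisj : ∀ F ∈ T, ∀ G ∈ T, ∀ x, x ∈ openCone (p ∘ F) → x ∈ openCone (p ∘ G) → F = G) :
    ∑ F ∈ T, ∑ m, ballProb.real (edgeWedge (p ∘ F) m) ≤ n := by
  classical
  rw [← Finset.sum_product' T Finset.univ fun F m => ballProb.real (edgeWedge (p ∘ F) m),
    ← Finset.sum_fiberwise (T ×ˢ Finset.univ) (fun a => a.1 a.2)]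
  have hi (i : Fin n) : ∑ a ∈ (T ×ˢ Finset.univ).filter (fun a => a.1 a.2 = i),
      ballProb.real (edgeWedge (p ∘ a.1) a.2) ≤ 1 := by
    rw [← measureReal_biUnion_finset]
    · exact measureReal_le_one
    · rintro ⟨F, m⟩ hF ⟨G, k⟩ hG hne
      rw [Function.onFun, Set.disjoint_left]
      intro x hxF hxG
      simp only [Finset.coe_filter, Finset.mem_product, Finset.mem_univ, and_true,
        Set.mem_ofPred_eq] at hF hG
      obtain ⟨ε, h1, h2⟩ := ((exists_mem_openCone_of_mem_edgeWedge (hdet F hF.1) hxF).and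
        (exists_mem_openCone_of_mem_edgeWedge (hdet G hG.1) hxG)).exists
      simp only [Function.comp_apply, hF.2, hG.2] at h1 h2
      have hFG := hdisj F hF.1 G hG.1 _ h1 h2
      subst hFG
      have hmk := injective_of_tripleDet_pos (hdet F hF.1) (hF.2.trans hG.2.symm)
      exact hne (by rw [hmk])
    · exact fun a _ => (isOpen_openWedge _ _).measurableSet
  calc _ ≤ ∑ i : Fin n, (1 : ℝ) := Finset.sum_le_sum fun i _ => hi i
    _ = n := by simp

/-- Euler's bound for the number of triangles of a triangulated sphere. -/
theorem card_triangulation_add_four_le (hdet : ∀ F ∈ T, 0 < tripleDet (p ∘ F))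
    (hdisj : ∀ F ∈ T, ∀ G ∈ T, ∀ x, x ∈ openCone (p ∘ F) → x ∈ openCone (p ∘ G) → F = G)
    (hcov : ∀ᵐ x : E3, ∃ F ∈ T, x ∈ openCone (p ∘ F)) : (T.card : ℝ) + 4 ≤ 2 * n := by
  have h1 := sum_ballProb_openCone hdisj hcov
  have h2 := sum_ballProb_edgeWedge_le hdet hdisj
  -- Summing Girard's formula over `T` gives 2 + |T|/2 ≤ n.
  have h3 : ∑ F ∈ T, ∑ m, ballProb.real (edgeWedge (p ∘ F) m) =
      ∑ F ∈ T, (2 * ballProb.real (openCone (p ∘ F)) + 1 / 2) :=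
    Finset.sum_congr rfl fun F hF => by rw [two_mul_ballProb_openCone _ (hdet F hF)]; ring
  rw [h3, Finset.sum_add_distrib, ← Finset.mul_sum, h1] at h2
  simp at h2
  linarith

end Triangulation

/-! ### Volumes of simplices and of the polytope -/

/-- The eight images under sign changes are disjoint and lie in the ℓ¹ unit ball, of volume 8/6. -/
lemma volume_corner_simplex_le : volume {c : Fin 3 → ℝ | (∀ i, 0 < c i) ∧ ∑ i, c i ≤ 1} ≤
    ENNReal.ofReal (1 / 6) := by
  set Δ := {c : Fin 3 → ℝ | (∀ i, 0 < c i) ∧ ∑ i, c i ≤ 1}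
  have hΔ : MeasurableSet Δ := by
    have : Δ = (⋂ i, {c | 0 < c i}) ∩ {c | ∑ i, c i ≤ 1} := by ext; simp [Δ]
    rw [this]
    exact (MeasurableSet.iInter fun i =>
      measurableSet_lt measurable_const (measurable_pi_apply i)).inter
      (measurableSet_le (by fun_prop) measurable_const)
  let φ (ε : Fin 3 → ℤˣ) (x : Fin 3 → ℝ) : Fin 3 → ℝ := fun i => ((ε i : ℤ) : ℝ) * x i
  have hφ (ε : Fin 3 → ℤˣ) : MeasurePreserving (φ ε) volume volume := by
    refine volume_preserving_pi (f := fun i (x : ℝ) => ((ε i : ℤ) : ℝ) * x) fun i => ?_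
    rcases Int.units_eq_one_or (ε i) with h | h
    · simp only [h, Units.val_one, Int.cast_one, one_mul]
      exact MeasurePreserving.id volume
    · simpa [h] using Measure.measurePreserving_neg (volume : Measure ℝ)
  have hsq (u : ℤˣ) : |((u : ℤ) : ℝ)| = 1 := by
    rcases Int.units_eq_one_or u with h | h <;> simp [h]
  have hsum : ∑ ε : Fin 3 → ℤˣ, volume (φ ε ⁻¹' Δ) ≤ ENNReal.ofReal (8 / 6) := by
    rw [← tsum_fintype (L := .unconditional _), ← measure_iUnion]
    · have hball := volume_sum_rpow_le (Fin 3) (p := 1) le_rfl 1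
      have : ENNReal.ofReal (1 : ℝ) ^ Fintype.card (Fin 3) * ENNReal.ofReal
          ((2 * Real.Gamma (1 / 1 + 1)) ^ Fintype.card (Fin 3) /
            Real.Gamma ((Fintype.card (Fin 3) : ℝ) / 1 + 1)) = ENNReal.ofReal (8 / 6) := by
        have h4 : Real.Gamma ((3 : ℝ) + 1) = 6 := by
          have := Real.Gamma_nat_eq_factorial 3
          norm_num [Nat.factorial] at this ⊢
        have h2 : Real.Gamma (1 + 1) = 1 := by
          have := Real.Gamma_nat_eq_factorial 1
          norm_num at this ⊢
        simp [h4, h2]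
        norm_num
      rw [← this, ← hball]
      refine measure_mono (Set.iUnion_subset fun ε x hx => ?_)
      obtain ⟨h1, h2⟩ := hx
      simp only [Real.rpow_one, div_one, Set.mem_ofPred_eq]
      refine le_trans (le_of_eq (Finset.sum_congr rfl fun i _ => ?_)) h2
      have h3 := h1 i
      rw [← abs_of_pos h3, abs_mul, hsq, one_mul]
    · intro ε ε' hne
      rw [Function.onFun, Set.disjoint_left]
      intro x hx hx'
      refine hne (funext fun i => ?_)
      have h1 : 0 < ((ε i : ℤ) : ℝ) * x i := hx.1 i
      have h2 : 0 < ((ε' i : ℤ) : ℝ) * x i := hx'.1 i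
      rcases Int.units_eq_one_or (ε i) with h | h <;> rcases Int.units_eq_one_or (ε' i) with h' | h'
        <;> rw [h, h'] <;> rw [h] at h1 <;> rw [h'] at h2 <;> simp at h1 h2 <;> linarith
    · exact fun ε => (hφ ε).measurable hΔ
  have hconst : ∑ ε : Fin 3 → ℤˣ, volume (φ ε ⁻¹' Δ) = 8 * volume Δ := by
    rw [Finset.sum_congr rfl fun ε _ => (hφ ε).measure_preimage hΔ.nullMeasurableSet]
    simp
  rw [hconst] at hsum
  have h8 : ENNReal.ofReal (8 / 6) = 8 * ENNReal.ofReal (1 / 6) := by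
    rw [show (8 / 6 : ℝ) = 8 * (1 / 6) by norm_num, ENNReal.ofReal_mul (by norm_num)]
    norm_num
  rw [h8] at hsum
  exact (ENNReal.mul_le_mul_iff_right (by norm_num) (by norm_num)).1 hsum

/-- The volume of a simplex with a vertex at the origin. -/
lemma volume_simplex_le (q : Fin 3 → E3) (hq : 0 < tripleDet q) :
    volume {x | x ∈ openCone q ∧ ∑ m, ⟪coneNormal q m, x⟫ ≤ tripleDet q} ≤
      ENNReal.ofReal (tripleDet q / 6) := by
  set S := {x | x ∈ openCone q ∧ ∑ m, ⟪coneNormal q m, x⟫ ≤ tripleDet q}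
  have hS : MeasurableSet S := by
    have : IsClosed {x : E3 | ∑ m, ⟪coneNormal q m, x⟫ ≤ tripleDet q} :=
      isClosed_le (by fun_prop) continuous_const
    exact (isOpen_openCone q).measurableSet.inter this.measurableSet
  let B : Matrix (Fin 3) (Fin 3) ℝ := Matrix.of fun i m => q m i
  have hB : B.det = tripleDet q := by
    rw [Matrix.det_fin_three]
    simp [B, tripleDet, inner_E3, crossE]
    ring
  rw [← (PiLp.volume_preserving_toLp (Fin 3)).measure_preimage hS.nullMeasurableSet]
  calc _ ≤ volume (Matrix.toLin' B '' {c : Fin 3 → ℝ | (∀ i, 0 < c i) ∧ ∑ i, c i ≤ 1}) := by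
        refine measure_mono fun x hx => ?_
        obtain ⟨h1, h2⟩ := hx
        refine ⟨fun m => ⟪coneNormal q m, WithLp.toLp 2 x⟫ / tripleDet q,
          ⟨fun m => div_pos (h1 m) hq, ?_⟩, ?_⟩
        · rw [← Finset.sum_div]
          exact (div_le_one hq).2 h2
        · have h3 := tripleDet_smul_eq_sum q (WithLp.toLp 2 x)
          funext i
          have h4 := congrArg (fun y : E3 => y i) h3
          simp [Fin.sum_univ_three] at h4
          simp [Matrix.toLin'_apply, Matrix.mulVec, dotProduct, B, Fin.sum_univ_three]
          field_simp
          linarith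
    _ ≤ _ := by
        rw [Measure.addHaar_image_linearMap, LinearMap.det_toLin', hB, abs_of_pos hq,
          div_eq_mul_one_div, ENNReal.ofReal_mul hq.le]
        exact mul_le_mul_right volume_corner_simplex_le _

/-- The volume of a polytope around the origin is at most the sum of the volumes of the cones
over the triangles of a triangulation of its boundary. -/
lemma volume_hull_le_sum {n : ℕ} (p : Fin n → E3) (T : Finset (Fin 3 → Fin n))
    (hdet : ∀ F ∈ T, 0 < tripleDet (p ∘ F))
    (hface : ∀ F ∈ T, ∀ l, ∑ m, ⟪coneNormal (p ∘ F) m, p l⟫ ≤ tripleDet (p ∘ F))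
    (hcov : ∀ᵐ x : E3, ∃ F ∈ T, x ∈ openCone (p ∘ F)) :
    volume.real (convexHull ℝ (Set.range p)) ≤ ∑ F ∈ T, tripleDet (p ∘ F) / 6 := by
  have h0 : ∀ F ∈ T, 0 ≤ tripleDet (p ∘ F) / 6 := fun F hF => by linarith [hdet F hF]
  refine ENNReal.toReal_le_of_le_ofReal (Finset.sum_nonneg h0) ?_
  rw [ENNReal.ofReal_sum_of_nonneg h0]
  let S (F : Fin 3 → Fin n) : Set E3 :=
    {x | x ∈ openCone (p ∘ F) ∧ ∑ m, ⟪coneNormal (p ∘ F) m, x⟫ ≤ tripleDet (p ∘ F)}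
  calc volume (convexHull ℝ (Set.range p)) ≤ volume (⋃ F ∈ T, S F) := by
        refine measure_mono_ae ?_
        filter_upwards [hcov] with x hx hxP
        obtain ⟨F, hF, hxF⟩ := hx
        refine Set.mem_biUnion hF ⟨hxF, ?_⟩
        have hsub : convexHull ℝ (Set.range p) ⊆
            {x | (∑ m, innerₛₗ ℝ (coneNormal (p ∘ F) m)) x ≤ tripleDet (p ∘ F)} := by
          refine convexHull_min ?_ (convex_halfSpace_le (LinearMap.isLinear _) _)
          rintro _ ⟨l, rfl⟩
          simpa using hface F hF l
        simpa using hsub hxP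
    _ ≤ ∑ F ∈ T, volume (S F) := measure_biUnion_finset_le _ _
    _ ≤ _ := Finset.sum_le_sum fun F hF => volume_simplex_le _ (hdet F hF)

/-! ### The volume bound for two classes of vertices -/

/-- If the points of a polytope on the unit sphere with eight vertices form two classes such that
distinct points of one class have inner product `-1/3`, then its volume is at most that of the
inscribed cube. -/
theorem volume_hull_le_of_classes (p : Fin 8 → E3) (hn : ∀ i, ‖p i‖ = 1) (cls : Fin 8 → Bool)
    (hcls : ∀ i j, i ≠ j → cls i = cls j → ⟪p i, p j⟫ = (-1 / 3 : ℝ))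
    (h0 : (0 : E3) ∈ interior (convexHull ℝ (Set.range p))) :
    volume.real (convexHull ℝ (Set.range p)) ≤ 8 / (3 * √3) := by
  obtain ⟨T, hdet, hface, hdisj, hcov⟩ := exists_boundary_triangulation p h0
  have hcard := card_triangulation_add_four_le hdet hdisj hcov
  have hone := sum_ballProb_openCone hdisj hcov
  have hbound : ∀ F ∈ T, tripleDet (p ∘ F) / 6 ≤ 2 / (9 * √3) - 2 * Real.pi / 81 +
      2 / 27 * (4 * Real.pi * ballProb.real (openCone (p ∘ F))) := by
    intro F hF
    -- Pigeonhole: three vertices, two classes. A cyclic rotation by `k` moves the edge within one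
    -- class to the first two places.
    obtain ⟨k, hk⟩ : ∃ k, cls (F k) = cls (F (1 + k)) := by
      by_contra! h
      have e0 : cls (F 0) ≠ cls (F 1) := h 0
      have e1 : cls (F 1) ≠ cls (F 2) := h 1
      have e2 : cls (F 2) ≠ cls (F 0) := h 2
      revert e0 e1 e2
      cases cls (F 0) <;> cases cls (F 1) <;> cases cls (F 2) <;> simp
    have hinj := injective_of_tripleDet_pos (hdet F hF)
    have := tripleDet_div_six_le (fun m => (p ∘ F) (m + k))
      (by rw [tripleDet_rotate]; exact hdet F hF) (fun i => hn _) (by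
        simp only [zero_add, Function.comp_apply]
        exact hcls _ _ (hinj.ne (by fin_cases k <;> decide)) hk)
    rwa [tripleDet_rotate, openCone_rotate] at this
  -- Needed because the number of triangles is only bounded above by 12.
  have hα : 0 ≤ 2 / (9 * √3) - 2 * Real.pi / 81 := by
    have h3 : √3 ^ 2 = 3 := Real.sq_sqrt (by norm_num)
    have h3' : 0 < √3 := by positivity
    have h4 : √3 < 2 := by nlinarith
    have : 1 / 9 ≤ 2 / (9 * √3) := by
      rw [div_le_div_iff₀ (by norm_num) (by positivity)]; linarith
    linarith [Real.pi_lt_four]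
  refine (volume_hull_le_sum p T hdet hface hcov).trans ((Finset.sum_le_sum hbound).trans ?_)
  rw [Finset.sum_add_distrib, Finset.sum_const, nsmul_eq_mul, ← Finset.mul_sum, ← Finset.mul_sum,
    hone]
  have hc : (T.card : ℝ) ≤ 12 := by norm_num at hcard; linarith
  have h8 : 8 / (3 * √3) = 12 * (2 / (9 * √3)) := by field_simp; norm_num
  have := mul_le_mul_of_nonneg_right hc hα
  rw [h8]
  linarith

/-! ### Inscribed regular tetrahedra -/

section Tetrahedron

lemma sum_mul_inner_of_inner_eq (s : Fin 4 → E3) (hn : ∀ i, ‖s i‖ = 1) (k : ℝ)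
    (hk : ∀ i j, i ≠ j → ⟪s i, s j⟫ = k) (w : Fin 4 → ℝ) (j : Fin 4) :
    ⟪s j, ∑ i, w i • s i⟫ = (1 - k) * w j + k * ∑ i, w i := by
  rw [inner_sum, ← Finset.add_sum_erase _ _ (Finset.mem_univ j),
    ← Finset.add_sum_erase _ w (Finset.mem_univ j), inner_smul_right, real_inner_self_eq_norm_sq,
    hn, mul_add, Finset.mul_sum]
  have : ∑ i ∈ Finset.univ.erase j, ⟪s j, w i • s i⟫ = ∑ i ∈ Finset.univ.erase j, k * w i :=
    Finset.sum_congr rfl fun i hi => by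
      rw [inner_smul_right, hk j i (Finset.ne_of_mem_erase hi).symm, mul_comm]
  rw [this]; ring

/-- Let k be the common inner product. Pairing the barycentric expansion of 0 with each vertex gives
(1 - k) b_j + k = 0; summation forces k = -1/3, whence every b_j is 1/4 and the origin is interior.
-/
lemma IsInscribedRegularTetrahedron.exists_points {S : Set E3}
    (hS : IsInscribedRegularTetrahedron S) :
    ∃ s : Fin 4 → E3, Set.range s = S ∧ (∀ i, ‖s i‖ = 1) ∧
      (∀ i j, i ≠ j → ⟪s i, s j⟫ = (-1 / 3 : ℝ)) ∧
      (0 : E3) ∈ interior (convexHull ℝ (Set.range s)) := by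
  obtain ⟨Δ, hreg, rfl, hsph⟩ := hS
  have hn : ∀ i, ‖Δ.points i‖ = 1 := fun i => by simpa using hsph ⟨i, rfl⟩
  obtain ⟨r, hr⟩ := hreg.equilateral
  have hk : ∀ i j, i ≠ j → ⟪Δ.points i, Δ.points j⟫ = 1 - r ^ 2 / 2 := fun i j hij => by
    have h1 := norm_sub_sq_real (Δ.points i) (Δ.points j)
    rw [← dist_eq_norm, hr i j hij, hn, hn] at h1
    linarith
  have hr0 : r ≠ 0 := by
    rw [← hr 0 1 (by decide)]
    exact dist_ne_zero.2 (Δ.independent.injective.ne (by decide))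
  have hspan : affineSpan ℝ (Set.range Δ.points) = ⊤ :=
    Δ.independent.affineSpan_eq_top_iff_card_eq_finrank_add_one.2 (by simp)
  let b : AffineBasis (Fin 4) ℝ E3 := ⟨Δ.points, Δ.independent, hspan⟩
  have hw1 : ∑ i, b.coord i 0 = 1 := b.sum_coord_apply_eq_one 0
  have hw0 : ∑ i, b.coord i 0 • Δ.points i = 0 := b.linear_combination_coord_eq_self 0
  set k := 1 - r ^ 2 / 2 with hkdef
  have hwj (j : Fin 4) : (1 - k) * b.coord j 0 + k = 0 := by
    have h1 := sum_mul_inner_of_inner_eq Δ.points hn k hk (fun i => b.coord i 0) j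
    rw [hw0, inner_zero_right, hw1, mul_one] at h1
    exact h1.symm
  have hkv : k = -1 / 3 := by
    have h1 : ∑ j : Fin 4, ((1 - k) * b.coord j 0 + k) = 0 := Finset.sum_eq_zero fun j _ => hwj j
    rw [Finset.sum_add_distrib, ← Finset.mul_sum, hw1] at h1
    simp at h1
    linarith
  refine ⟨Δ.points, rfl, hn, fun i j hij => by rw [hk i j hij, hkv], ?_⟩
  have hint := b.interior_convexHull
  change interior (convexHull ℝ (Set.range Δ.points)) = _ at hint
  rw [hint]
  intro j
  have := hwj j
  rw [hkv] at this
  linarith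

lemma isInscribedRegularTetrahedron_range (s : Fin 4 → E3) (hn : ∀ i, ‖s i‖ = 1)
    (hk : ∀ i j, i ≠ j → ⟪s i, s j⟫ = (-1 / 3 : ℝ)) :
    IsInscribedRegularTetrahedron (Set.range s) := by
  have hind : AffineIndependent ℝ s := by
    rw [affineIndependent_iff_of_fintype]
    intro w hw h i
    rw [Finset.weightedVSub_eq_weightedVSubOfPoint_of_sum_eq_zero _ _ _ hw 0,
      Finset.weightedVSubOfPoint_apply] at h
    have h1 := sum_mul_inner_of_inner_eq s hn _ hk w i
    simp only [vsub_eq_sub, sub_zero] at h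
    rw [h, hw, inner_zero_right] at h1
    linarith
  refine ⟨⟨s, hind⟩, ?_, rfl, ?_⟩
  · intro σ
    change ∃ x : E3 ≃ᵢ E3, s ∘ σ = x ∘ s
    induction σ using Equiv.Perm.swap_induction_on with
    | one => exact ⟨IsometryEquiv.refl _, rfl⟩
    | swap_mul f i j hij ih =>
      obtain ⟨x, hx⟩ := ih
      -- The reflection exchanging two vertices fixes the others, because their inner products with
      -- both are equal.
      let R := (ℝ ∙ (s i - s j))ᗮ.reflection
      have hR : s ∘ Equiv.swap i j = R ∘ s := by
        funext l
        have hij' : ‖s i‖ = ‖s j‖ := by rw [hn, hn]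
        have hRi : R (s i) = s j := Submodule.reflection_sub hij'
        by_cases hli : l = i
        · subst hli; simp [hRi]
        by_cases hlj : l = j
        · subst hlj
          simp only [Function.comp_apply, Equiv.swap_apply_right]
          rw [← hRi]
          exact (Submodule.reflection_reflection _ _).symm
        · simp only [Function.comp_apply, Equiv.swap_apply_of_ne_of_ne hli hlj]
          refine (Submodule.reflection_mem_subspace_eq_self ?_).symm
          rw [Submodule.mem_orthogonal_singleton_iff_inner_left, inner_sub_right, hk _ _ hli,
            hk _ _ hlj, sub_self]
      refine ⟨x.trans R.toIsometryEquiv, funext fun l => ?_⟩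
      exact (congrFun hR (f l)).trans (congrArg R (congrFun hx l))
  · rintro _ ⟨i, rfl⟩
    simpa using hn i

end Tetrahedron

/-! ### Inscribed cubes -/

section Cube

lemma volume_hull_cube (a : ℝ) (ha : 0 < a) (b : OrthonormalBasis (Fin 3) ℝ E3) :
    hullVolume {x | ∃ ε : Fin 3 → ℝ, (∀ i, ε i = 1 ∨ ε i = -1) ∧ x = ∑ i, (a * ε i) • b i} =
      8 * a ^ 3 := by
  let e : (Fin 3 → ℝ) ≃ₗ[ℝ] E3 :=
    (WithLp.linearEquiv 2 ℝ (Fin 3 → ℝ)).symm.trans b.repr.symm.toLinearEquiv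
  have he (c : Fin 3 → ℝ) : e c = ∑ i, c i • b i := b.sum_repr_symm (WithLp.toLp 2 c) |>.symm
  have hC : {x | ∃ ε : Fin 3 → ℝ, (∀ i, ε i = 1 ∨ ε i = -1) ∧ x = ∑ i, (a * ε i) • b i} =
      e '' (Set.univ.pi fun _ => {-a, a}) := by
    ext x
    constructor
    · rintro ⟨ε, hε, rfl⟩
      refine ⟨fun i => a * ε i, fun i _ => ?_, he _⟩
      rcases hε i with h | h <;> simp [h]
    · rintro ⟨c, hc, rfl⟩
      refine ⟨fun i => c i / a, fun i => ?_, ?_⟩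
      · rcases hc i (Set.mem_univ i) with h | h
        · right; simp only [h]; field_simp
        · left; simp only [Set.mem_singleton_iff.1 h]; field_simp
      · rw [he]
        refine Finset.sum_congr rfl fun i _ => ?_
        rw [mul_div_cancel₀ _ ha.ne']
  have hmp : MeasurePreserving (e : (Fin 3 → ℝ) → E3) volume volume :=
    b.measurePreserving_repr_symm.comp (PiLp.volume_preserving_toLp (Fin 3))
  have hhull : convexHull ℝ (e '' (Set.univ.pi fun _ => {-a, a})) =
      e '' Set.Icc (fun _ => -a) (fun _ => a) := by
    rw [← Set.pi_univ_Icc, ← LinearEquiv.coe_toLinearMap, ← LinearMap.image_convexHull,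
      convexHull_pi]
    congr 2
    funext i
    rw [convexHull_pair, segment_eq_Icc (by linarith)]
  rw [hullVolume, hC, hhull, Measure.real, ← hmp.measure_preimage,
    Set.preimage_image_eq _ e.injective, Real.volume_Icc_pi]
  · rw [ENNReal.toReal_prod]
    simp only [Fin.prod_univ_three]
    rw [ENNReal.toReal_ofReal (by linarith)]
    ring
  · exact (isCompact_Icc.image
      (LinearMap.continuous_of_finiteDimensional e.toLinearMap)).measurableSet.nullMeasurableSet

lemma norm_sq_sum_signs (a : ℝ) (b : OrthonormalBasis (Fin 3) ℝ E3) (ε : Fin 3 → ℝ)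
    (hε : ∀ i, ε i = 1 ∨ ε i = -1) : ‖∑ i, (a * ε i) • b i‖ ^ 2 = 3 * a ^ 2 := by
  rw [← b.sum_sq_norm_inner_right]
  have h (i : Fin 3) : ⟪b i, ∑ j, (a * ε j) • b j⟫ = a * ε i := by
    rw [b.orthonormal.inner_right_fintype]
  simp only [h]
  have h2 (i : Fin 3) : ‖a * ε i‖ ^ 2 = a ^ 2 := by
    rcases hε i with h | h <;> simp [h]
  simp only [h2]
  simp

theorem IsInscribedCube.hullVolume_eq {C : Set E3} (hC : IsInscribedCube C) :
    hullVolume C = 8 / (3 * √3) := by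
  obtain ⟨⟨c, a, b, ha, rfl⟩, hsph⟩ := hC
  have h1 (ε : Fin 3 → ℝ) (hε : ∀ i, ε i = 1 ∨ ε i = -1) :
      ‖c + ∑ i, (a * ε i) • b i‖ = 1 := by simpa using hsph ⟨ε, hε, rfl⟩
  have h2 (ε : Fin 3 → ℝ) (hε : ∀ i, ε i = 1 ∨ ε i = -1) :
      ⟪c, ∑ i, (a * ε i) • b i⟫ = (0 : ℝ) ∧ ‖c‖ ^ 2 + 3 * a ^ 2 = 1 := by
    -- Opposite vertices have the same norm, so `c` is orthogonal to every diagonal.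
    have e1 := norm_add_sq_real c (∑ i, (a * ε i) • b i)
    have e2 := norm_sub_sq_real c (∑ i, (a * ε i) • b i)
    have e3 := h1 (-ε) (fun i => by rcases hε i with h | h <;> simp [h])
    have e4 : c + ∑ i, (a * (-ε) i) • b i = c - ∑ i, (a * ε i) • b i := by
      simp [sub_eq_add_neg]
    rw [h1 ε hε, norm_sq_sum_signs a b ε hε] at e1
    rw [← e4, e3, norm_sq_sum_signs a b ε hε] at e2
    constructor <;> linarith
  have hcb (i : Fin 3) : ⟪c, b i⟫ = (0 : ℝ) := by
    have e1 := (h2 (fun _ => 1) (fun _ => Or.inl rfl)).1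
    have e2 := (h2 (Function.update (fun _ => 1) i (-1)) (fun j => by
      by_cases h : j = i
      · subst h; simp
      · simp [h])).1
    -- Two diagonals differing in one sign isolate a single basis vector; hence `c` vanishes.
    have e3 : ∑ j, (a * (1 : ℝ)) • b j =
        ∑ j, (a * Function.update (fun _ => (1 : ℝ)) i (-1) j) • b j + (2 * a) • b i := by
      rw [← Finset.add_sum_erase _ _ (Finset.mem_univ i),
        ← Finset.add_sum_erase _ (fun j => (a * Function.update (fun _ => (1 : ℝ)) i (-1) j) • b j)
          (Finset.mem_univ i)]
      have : ∑ j ∈ Finset.univ.erase i, (a * Function.update (fun _ => (1 : ℝ)) i (-1) j) • b j =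
          ∑ j ∈ Finset.univ.erase i, (a * (1 : ℝ)) • b j :=
        Finset.sum_congr rfl fun j hj => by
          rw [Function.update_of_ne (Finset.ne_of_mem_erase hj)]
      rw [this, Function.update_self]
      module
    rw [e3, inner_add_right, e2, inner_smul_right, zero_add] at e1
    exact (mul_eq_zero.1 e1).resolve_left (by positivity)
  have hc : c = 0 := by
    rw [← b.sum_repr' c]
    refine Finset.sum_eq_zero fun i _ => ?_
    rw [real_inner_comm, hcb, zero_smul]
  subst hc
  have ha2 : 3 * a ^ 2 = 1 := by
    simpa using (h2 (fun _ => 1) (fun _ => Or.inl rfl)).2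
  have ha3 : a = 1 / √3 := by
    rw [eq_div_iff (by positivity), ← sq_eq_sq₀ (by positivity) (by norm_num), mul_pow,
      Real.sq_sqrt (by norm_num)]
    linarith
  simp only [zero_add]
  rw [volume_hull_cube a ha b, ha3]
  have s3 : √3 ^ 2 = 3 := Real.sq_sqrt (by norm_num)
  field_simp
  linear_combination -s3

end Cube

/-! ### The bound for two tetrahedra and the extremal pair -/

/-- The two vertex families are concatenated as indexed families, so shared vertices do no harm. -/
lemma hullVolume_union_le {S T : Set E3} (hS : IsInscribedRegularTetrahedron S)
    (hT : IsInscribedRegularTetrahedron T) : hullVolume (S ∪ T) ≤ 8 / (3 * √3) := by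
  obtain ⟨s, rfl, hsn, hs, h0⟩ := hS.exists_points
  obtain ⟨t, rfl, htn, ht, -⟩ := hT.exists_points
  let p : Fin (4 + 4) → E3 := Fin.append s t
  have hp : Set.range p = Set.range s ∪ Set.range t := by
    ext x
    constructor
    · rintro ⟨i, rfl⟩
      refine Fin.addCases (fun i => ?_) (fun i => ?_) i
      · left; exact ⟨i, by simp [p]⟩
      · right; exact ⟨i, (Fin.append_right s t i).symm⟩
    · rintro (⟨i, rfl⟩ | ⟨i, rfl⟩)
      · exact ⟨Fin.castAdd 4 i, by simp [p]⟩
      · exact ⟨Fin.natAdd 4 i, Fin.append_right s t i⟩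
  rw [hullVolume, ← hp]
  refine volume_hull_le_of_classes p ?_ (fun i => decide (i.val < 4)) ?_ ?_
  · intro i
    refine Fin.addCases (m := 4) (n := 4) (fun i => ?_) (fun i => ?_) i
    · simpa [p] using hsn i
    · simpa only [p, Fin.append_right] using htn i
  · intro i j
    refine Fin.addCases (m := 4) (n := 4) (fun i => ?_) (fun i => ?_) i <;>
    refine Fin.addCases (m := 4) (n := 4) (fun j => ?_) (fun j => ?_) j <;> intro hij hc
    · simpa [p] using hs i j (fun h => hij (by rw [h]))
    · simp at hc
    · simp at hc
    · simpa only [p, Fin.append_right] using ht i j (fun h => hij (by rw [h]))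
  · rw [hp]
    exact interior_mono (convexHull_mono Set.subset_union_left) h0

/-- Signs of the vertices of a regular tetrahedron inscribed in a cube. -/
def tetraSign : Fin 4 → Fin 3 → ℝ := ![![1, 1, 1], ![1, -1, -1], ![-1, 1, -1], ![-1, -1, 1]]

/-- The vertices of a regular tetrahedron inscribed in the unit sphere. -/
noncomputable def tetraPoint (i : Fin 4) : E3 := WithLp.toLp 2 fun j => 1 / √3 * tetraSign i j

lemma inner_tetraPoint (i j : Fin 4) :
    ⟪tetraPoint i, tetraPoint j⟫ = (if i = j then 1 else -1 / 3 : ℝ) := by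
  have s3 : (√3)⁻¹ * (√3)⁻¹ = 1 / 3 := by
    rw [← mul_inv, Real.mul_self_sqrt (by norm_num)]; norm_num
  have : ⟪tetraPoint i, tetraPoint j⟫ = 1 / 3 * (tetraSign i 0 * tetraSign j 0 +
      tetraSign i 1 * tetraSign j 1 + tetraSign i 2 * tetraSign j 2) := by
    rw [inner_E3, ← s3]
    simp only [tetraPoint, one_div]
    ring
  rw [this]
  fin_cases i <;> fin_cases j <;> simp [tetraSign] <;> norm_num

lemma isInscribedRegularTetrahedron_tetraPoint :
    IsInscribedRegularTetrahedron (Set.range tetraPoint) := by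
  refine isInscribedRegularTetrahedron_range _ (fun i => ?_) fun i j hij => ?_
  · rw [norm_eq_sqrt_real_inner, inner_tetraPoint]; simp
  · rw [inner_tetraPoint, if_neg hij]

lemma isInscribedRegularTetrahedron_neg_tetraPoint :
    IsInscribedRegularTetrahedron (Set.range fun i => -tetraPoint i) := by
  refine isInscribedRegularTetrahedron_range _ (fun i => ?_) fun i j hij => ?_
  · rw [norm_neg, norm_eq_sqrt_real_inner, inner_tetraPoint]; simp
  · rw [inner_neg_neg, inner_tetraPoint, if_neg hij]

lemma isInscribedCube_tetraPoint :
    IsInscribedCube (Set.range tetraPoint ∪ Set.range fun i => -tetraPoint i) := by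
  have hform (ε : Fin 3 → ℝ) : (0 : E3) + ∑ i, (1 / √3 * ε i) • EuclideanSpace.basisFun (Fin 3) ℝ i =
      WithLp.toLp 2 fun j => 1 / √3 * ε j := by
    ext j; fin_cases j <;> simp [Fin.sum_univ_three]
  refine ⟨⟨0, 1 / √3, EuclideanSpace.basisFun (Fin 3) ℝ, by positivity, ?_⟩, ?_⟩
  · ext x
    simp only [hform, Set.mem_ofPred_eq]
    constructor
    · rintro (⟨i, rfl⟩ | ⟨i, rfl⟩)
      · refine ⟨tetraSign i, fun j => ?_, rfl⟩
        fin_cases i <;> fin_cases j <;> simp [tetraSign]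
      · refine ⟨-tetraSign i, fun j => ?_, ?_⟩
        · fin_cases i <;> fin_cases j <;> simp [tetraSign]
        · ext j; simp [tetraPoint]
    · rintro ⟨ε, hε, rfl⟩
      -- The rows of `tetraSign` are the sign vectors of product 1; their negatives are those of
      -- product -1.
      have key : (∃ i, tetraSign i = ε) ∨ ∃ i, -tetraSign i = ε := by
        have hε3 : ε = ![ε 0, ε 1, ε 2] := by ext j; fin_cases j <;> rfl
        rw [hε3]
        rcases hε 0 with h0 | h0 <;> rcases hε 1 with h1 | h1 <;> rcases hε 2 with h2 | h2 <;>
          rw [h0, h1, h2]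
        · exact Or.inl ⟨0, by simp [tetraSign]⟩
        · exact Or.inr ⟨3, by simp [tetraSign]⟩
        · exact Or.inr ⟨2, by simp [tetraSign]⟩
        · exact Or.inl ⟨1, by simp [tetraSign]⟩
        · exact Or.inr ⟨1, by simp [tetraSign]⟩
        · exact Or.inl ⟨2, by simp [tetraSign]⟩
        · exact Or.inl ⟨3, by simp [tetraSign]⟩
        · exact Or.inr ⟨0, by simp [tetraSign]⟩
      rcases key with ⟨i, rfl⟩ | ⟨i, rfl⟩
      · exact Or.inl ⟨i, rfl⟩
      · exact Or.inr ⟨i, by ext j; simp [tetraPoint]⟩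
  · obtain ⟨-, -, -, h1⟩ := isInscribedRegularTetrahedron_tetraPoint
    obtain ⟨-, -, -, h2⟩ := isInscribedRegularTetrahedron_neg_tetraPoint
    exact Set.union_subset h1 h2

theorem mainTheorem3 :
    IsGreatest
      {v : ℝ | ∃ S T : Set E3, IsInscribedRegularTetrahedron S ∧
        IsInscribedRegularTetrahedron T ∧ v = hullVolume (S ∪ T)}
      (8 / (3 * √3)) ∧
    (∃ C : Set E3, IsInscribedCube C) ∧
    (∀ C : Set E3, IsInscribedCube C → hullVolume C = 8 / (3 * √3)) := by
  refine ⟨⟨⟨_, _, isInscribedRegularTetrahedron_tetraPoint,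
    isInscribedRegularTetrahedron_neg_tetraPoint,
    isInscribedCube_tetraPoint.hullVolume_eq.symm⟩, ?_⟩, ⟨_, isInscribedCube_tetraPoint⟩,
    fun C hC => hC.hullVolume_eq⟩
  rintro v ⟨S, T, hS, hT, rfl⟩
  exact hullVolume_union_le hS hT
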